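/- A \emph{square} is a topological disk with four privileged boundary points, its vertices. A \emph{quadriculated disk} $\Delta$ is a closed topological disk formed by the juxtaposition along sides of finitely many squares such that every interior vertex belongs to precisely four squares. Its squares can be colored black and white so that squares with a common side have opposite colors. Fix any such coloring, and label the black squares by $1,\dots,b$ and the white squares by $1,\dots,w$; the \emph{black-to-white matrix} $B_\Delta$ is the $b\times w$ matrix whose $(i,j)$ entry is $1$ if the $i$-th black and the $j$-th white square share a side, and $0$ otherwise. A rectangular matrix $\tilde D$ is a \emph{defective identity} if every entry equals $0$ or $1$ and if $\tilde d_{ij}=\tilde d_{i'j'}=1$ implies either $i=i'$, $j=j'$, or $i<i'$, $j<j'$, or $i>i'$, $j>j'$. \textbf{Theorem.} Let $\Delta$ be a quadriculated disk with at least two squares, and fix a coloring as above (one exists). For an appropriate labeling of the black squares and of the white squares, $B_\Delta = L\tilde D U$, where $L$ is a $b\times b$ invertible lower triangular matrix, $U$ is a $w\times w$ invertible upper triangular matrix, $\tilde D$ is a $b\times w$ defective identity, and all entries of $L$, $\tilde D$ and $U$ are equal to $0$, $1$ or $-1$. -/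

import Mathlib

open scoped unitInterval

/-- The model square is `I × I` with corners `0 = (0,0)`, `1 = (1,0)`, `2 = (1,1)`, `3 = (0,1)`,
listed counterclockwise.  `sidePoint k t` is the point at time `t` of side `k`, which is traversed
counterclockwise from corner `k` to corner `k + 1` (indices modulo `4`). -/
def sidePoint : Fin 4 → I → I × I
  | 0, t => (t, 0)
  | 1, t => (1, t)
  | 2, t => (unitInterval.symm t, 1)
  | 3, t => (0, unitInterval.symm t)

/-- Instructions for juxtaposing the squares of a family indexed by `S` along sides.
The pair `(s, k)` is side `k` of the square `s`.  The sides `d` and `mate d` are identified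
if they are different; if `mate d = d`, then the side `d` is not identified with any side. -/
structure SquareGluing (S : Type*) where
  mate : S × Fin 4 → S × Fin 4
  mate_mate : ∀ d, mate (mate d) = d

namespace SquareGluing

variable {S : Type*} (G : SquareGluing S)

/-- Identification of the points of two different mated sides.  Squares are oriented
counterclockwise, so the two sides are traversed in opposite directions. -/
inductive PointRel : (Σ _ : S, I × I) → (Σ _ : S, I × I) → Prop
  | glue (d : S × Fin 4) (hd : G.mate d ≠ d) (t : I) :
      PointRel ⟨d.1, sidePoint d.2 t⟩
        ⟨(G.mate d).1, sidePoint (G.mate d).2 (unitInterval.symm t)⟩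

/-- The topological space formed by the squares: the disjoint union of the squares with mated
sides identified, with the quotient topology. -/
abbrev Realization : Type _ := Quot G.PointRel

/-- The identification of corners that results from the gluing of sides; `(s, k)` is corner `k`
of the square `s`.  The starting point of a side is glued to the end point of its mate
(the other end point is covered by the same rule for the mate). -/
inductive CornerRel : S × Fin 4 → S × Fin 4 → Prop
  | glue (d : S × Fin 4) (hd : G.mate d ≠ d) :
      CornerRel d ((G.mate d).1, (G.mate d).2 + 1)

/-- The vertices: classes of corners under the equivalence relation generated by `CornerRel`. -/
abbrev Vertex : Type _ := Quot G.CornerRel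

/-- The vertex at corner `k` of the square `s`. -/
def vertex (s : S) (k : Fin 4) : G.Vertex := Quot.mk _ (s, k)

/-- A vertex is interior if it is not an end point of a boundary side,
that is, of a side that is not glued to another one. -/
def IsInterior (v : G.Vertex) : Prop :=
  ∀ (s : S) (k : Fin 4), G.mate (s, k) = (s, k) → v ≠ G.vertex s k ∧ v ≠ G.vertex s (k + 1)

/-- The set of squares to which a vertex belongs. -/
def squaresAt (v : G.Vertex) : Set S := {s | ∃ k, G.vertex s k = v}

/-- Two different squares share a side. -/
def Adj (s t : S) : Prop := s ≠ t ∧ ∃ k l, G.mate (s, k) = (t, l)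

/-- A coloring of the squares (`true` is black, `false` is white) in which squares with a
common side have opposite colors. -/
def IsBicoloring (c : S → Bool) : Prop := ∀ s t, G.Adj s t → c s ≠ c t

open Classical in
/-- The black-to-white matrix for given labelings of the black and of the white squares. -/
noncomputable def blackToWhite {c : S → Bool} {b w : ℕ}
    (β : Fin b ≃ {s // c s = true}) (ω : Fin w ≃ {s // c s = false}) :
    Matrix (Fin b) (Fin w) ℤ :=
  Matrix.of fun i j => if G.Adj (β i) (ω j) then 1 else 0

end SquareGluing

/-- A quadriculated disk with set of squares `S`: a closed topological disk formed by the
juxtaposition along sides of squares, each with four distinct vertices, such that every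
interior vertex belongs to precisely four squares. -/
structure QuadriculatedDisk (S : Type*) extends SquareGluing S where
  isDisk : Nonempty
    (toSquareGluing.Realization ≃ₜ Metric.closedBall (0 : EuclideanSpace ℝ (Fin 2)) 1)
  vertex_injective : ∀ s, Function.Injective (toSquareGluing.vertex s)
  interior_four : ∀ v, toSquareGluing.IsInterior v → (toSquareGluing.squaresAt v).ncard = 4

/-- A defective identity: a rectangular matrix with entries `0` and `1` in which the positions
of any two entries equal to `1` coincide or are strictly ordered in both coordinates. -/
def IsDefectiveIdentity {n m : ℕ} (D : Matrix (Fin n) (Fin m) ℤ) : Prop :=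
  (∀ i j, D i j = 0 ∨ D i j = 1) ∧
  ∀ i j i' j', D i j = 1 → D i' j' = 1 →
    (i = i' ∧ j = j') ∨ (i < i' ∧ j < j') ∨ (i' < i ∧ j' < j)

/-- Every entry equals `0`, `1` or `-1`. -/
def HasUnitEntries {n m : ℕ} (A : Matrix (Fin n) (Fin m) ℤ) : Prop :=
  ∀ i j, A i j = 0 ∨ A i j = 1 ∨ A i j = -1

/-!
Over the disk, as over any contractible space, a locally constant additive cocycle is a coboundary.
Hence a cochain on the glued sides is exact as soon as its sums around the interior vertices vanish.
Applied to the angles between adjacent squares, this turns the squares so that every neighbor lies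
to the east, north, west or south; applied again, it shows that the resulting grid is exact in every
abelian group, and the rest of the argument uses only this exactness.

Exactness with coefficients in a field bounds the Euler characteristic of a grid from below, so that
there are more convex corners than reflex ones. The diagonals that start at convex corners and run
until they leave the grid are disjoint, hence one of them does not end in a reflex corner. Gaussian
elimination along such a diagonal removes its squares together with the squares of the other color
on one side of it; up to signs, what remains is the adjacency matrix of the smaller grid obtained by
zipping up the cut along the diagonal. The signs come from one more application of exactness: they
are the parity of a height function that jumps by one across the diagonal.
-/

section Cech

variable {X A : Type*} [TopologicalSpace X]

theorem exists_continuous_rightInverse_of_isCoveringMap [ContractibleSpace X] {E : Type*}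
    [TopologicalSpace E] {p : E → X} (hp : IsCoveringMap p) (hsurj : Function.Surjective p) :
    ∃ sec : X → E, Continuous sec ∧ Function.RightInverse sec p := by
  obtain ⟨x₀, ⟨H⟩⟩ := id_nullhomotopic X
  obtain ⟨e₀, he₀⟩ := hsurj x₀
  have H₀ : ∀ x, H.symm.toContinuousMap (0, x) = p (ContinuousMap.const X e₀ x) := fun x =>
    (H.symm.apply_zero x).trans he₀.symm
  refine ⟨fun x => hp.liftHomotopy H.symm.toContinuousMap (.const X e₀) H₀ (1, x), by fun_prop,
    fun x => ?_⟩
  exact (congrFun (hp.liftHomotopy_lifts H.symm.toContinuousMap (.const X e₀) H₀) (1, x)).trans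
    (H.symm.apply_one x)

variable {ι : Type*} [AddCommGroup A] [TopologicalSpace A] [DiscreteTopology A]
  {U : ι → Set X} {T : ι → ι → X → A}

/-- The fiber bundle with fiber `A` whose transition functions are the translations by the cocycle
`T`; a covering, as `A` is discrete. -/
def cocycleBundleCore (hU : ∀ i, IsOpen (U i)) (indexAt : X → ι) (hmem : ∀ x, x ∈ U (indexAt x))
    (hT : ∀ i j, ContinuousOn (T i j) (U i ∩ U j))
    (hadd : ∀ i j k x, x ∈ U i → x ∈ U j → x ∈ U k → T i j x + T j k x = T i k x) :
    FiberBundleCore ι X A where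
  baseSet := U
  isOpen_baseSet := hU
  indexAt := indexAt
  mem_baseSet_at := hmem
  coordChange i j x a := a + T i j x
  coordChange_self i x hx a := by simpa using hadd i i i x hx hx hx
  continuousOn_coordChange i j := continuous_snd.continuousOn.add
    ((hT i j).comp continuous_fst.continuousOn fun _ hp => hp.1)
  coordChange_comp i j k x hx a := by rw [add_assoc, hadd i j k x hx.1.1 hx.1.2 hx.2]

theorem exists_coboundary_of_cocycle [ContractibleSpace X] (hU : ∀ i, IsOpen (U i))
    (hcov : ∀ x, ∃ i, x ∈ U i) (hT : ∀ i j, ContinuousOn (T i j) (U i ∩ U j))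
    (hadd : ∀ i j k x, x ∈ U i → x ∈ U j → x ∈ U k → T i j x + T j k x = T i k x) :
    ∃ φ : ι → X → A, (∀ i, ContinuousOn (φ i) (U i)) ∧
      ∀ i j x, x ∈ U i → x ∈ U j → φ j x = φ i x + T i j x := by
  choose idx hidx using hcov
  let Z := cocycleBundleCore hU idx hidx hT hadd
  have hZ : IsCoveringMap Z.proj := FiberBundle.isCoveringMap (F := A) (E := Z.Fiber)
  obtain ⟨sec, hsec, hsecZ⟩ := exists_continuous_rightInverse_of_isCoveringMap hZ fun x =>
    ⟨⟨x, (0 : A)⟩, rfl⟩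
  refine ⟨fun i x => (Z.localTriv i (sec x)).2, fun i => ?_, fun i j x hi hj => ?_⟩
  · refine continuous_snd.comp_continuousOn
      ((Z.localTriv i).continuousOn_toFun.comp hsec.continuousOn fun x hx => ?_)
    rw [(Z.localTriv i).source_eq]
    exact Set.mem_preimage.mpr ((hsecZ x).symm ▸ hx)
  · let a : A := (sec x).2
    have hφ : ∀ k, (Z.localTriv k (sec x)).2 = a + T (idx x) k x := fun k => by
      change a + T (idx (Z.proj (sec x))) k (Z.proj (sec x)) = _
      rw [hsecZ]
    simp only [hφ]
    rw [add_assoc, hadd (idx x) i j x (hidx x) hi hj]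

end Cech

section BorderedMatrices

variable {n m k l : ℕ}

/-- The matrix `A` bordered by a first row `a, r` and a first column `a, c`. -/
def bordered (a : ℤ) (r : Fin m → ℤ) (c : Fin n → ℤ) (A : Matrix (Fin n) (Fin m) ℤ) :
    Matrix (Fin (n + 1)) (Fin (m + 1)) ℤ :=
  Matrix.of (Fin.cons (Fin.cons a r) fun i => Fin.cons (c i) (A i))

variable {a : ℤ} {r : Fin m → ℤ} {c : Fin n → ℤ} {A : Matrix (Fin n) (Fin m) ℤ}

@[simp] theorem bordered_zero_zero : bordered a r c A 0 0 = a := rfl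

@[simp] theorem bordered_zero_succ (j : Fin m) : bordered a r c A 0 j.succ = r j := rfl

@[simp] theorem bordered_succ_zero (i : Fin n) : bordered a r c A i.succ 0 = c i := rfl

@[simp] theorem bordered_succ_succ (i : Fin n) (j : Fin m) :
    bordered a r c A i.succ j.succ = A i j := rfl

theorem bordered_transpose : (bordered a r c A).transpose = bordered a c r A.transpose := by
  ext i j
  cases i using Fin.cases <;> cases j using Fin.cases <;> rfl

theorem bordered_mul_bordered_mul_bordered {L : Matrix (Fin n) (Fin k) ℤ}
    {D : Matrix (Fin k) (Fin l) ℤ} {U : Matrix (Fin l) (Fin m) ℤ} :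
    bordered 1 0 c L * bordered 1 0 0 D * bordered 1 r 0 U =
      bordered 1 r c (Matrix.vecMulVec c r + L * D * U) := by
  ext i j
  cases i using Fin.cases <;> cases j using Fin.cases <;>
    simp [Matrix.mul_apply, Fin.sum_univ_succ, Matrix.vecMulVec_apply]

/-- The matrix `A` with an additional first row, which is zero. -/
def consZeroRow (A : Matrix (Fin n) (Fin m) ℤ) : Matrix (Fin (n + 1)) (Fin m) ℤ :=
  Matrix.of (Fin.cons 0 A)

@[simp] theorem consZeroRow_zero (j : Fin m) : consZeroRow A 0 j = 0 := rfl

@[simp] theorem consZeroRow_succ (i : Fin n) (j : Fin m) : consZeroRow A i.succ j = A i j := rfl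

/-- A square matrix that is lower triangular, invertible and has entries `0`, `1` and `-1`: the
shape of the left factor, and of the transpose of the right factor, of a factorization. -/
structure IsUnitLowerTriangular (L : Matrix (Fin n) (Fin n) ℤ) : Prop where
  isLowerTriangular : L.IsLowerTriangular
  isUnit : IsUnit L
  hasUnitEntries : HasUnitEntries L

theorem IsUnitLowerTriangular.bordered_one {L : Matrix (Fin n) (Fin n) ℤ}
    (hL : IsUnitLowerTriangular L) (hc : ∀ i, c i = 0 ∨ c i = 1 ∨ c i = -1) :
    IsUnitLowerTriangular (bordered 1 0 c L) := by
  have htri : (bordered 1 0 c L).IsLowerTriangular := fun i j (hij : i < j) => by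
    cases i using Fin.cases <;> cases j using Fin.cases
    · exact absurd hij (lt_irrefl _)
    · rfl
    · exact absurd hij (Fin.not_lt_zero _)
    · exact hL.isLowerTriangular (Fin.succ_lt_succ_iff.mp hij)
  refine ⟨htri, ?_, fun i j => ?_⟩
  · have hdet := (Matrix.isUnit_iff_isUnit_det _).mp hL.isUnit
    rw [Matrix.det_of_isLowerTriangular _ hL.isLowerTriangular] at hdet
    rw [Matrix.isUnit_iff_isUnit_det, Matrix.det_of_isLowerTriangular _ htri, Fin.prod_univ_succ]
    simpa using hdet
  · cases i using Fin.cases <;> cases j using Fin.cases <;> simp [hc, hL.hasUnitEntries _ _]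

theorem IsUnitLowerTriangular.diagonal_mul {L : Matrix (Fin n) (Fin n) ℤ}
    (hL : IsUnitLowerTriangular L) {ε : Fin n → ℤ} (hε : ∀ i, ε i = 1 ∨ ε i = -1) :
    IsUnitLowerTriangular (Matrix.diagonal ε * L) := by
  refine ⟨fun i j hij => ?_, IsUnit.mul ?_ hL.isUnit, fun i j => ?_⟩
  · rw [Matrix.diagonal_mul, hL.isLowerTriangular hij, mul_zero]
  · refine IsUnit.of_mul_eq_one (Matrix.diagonal ε) ?_
    rw [Matrix.diagonal_mul_diagonal, ← Matrix.diagonal_one]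
    congr 1
    funext i
    rcases hε i with h | h <;> simp [h]
  · rw [Matrix.diagonal_mul]
    rcases hε i with h | h <;> rcases hL.hasUnitEntries i j with h' | h' | h' <;> simp [h, h']

theorem isUnitLowerTriangular_zero (L : Matrix (Fin 0) (Fin 0) ℤ) : IsUnitLowerTriangular L :=
  ⟨fun i => i.elim0, Subsingleton.elim 1 L ▸ isUnit_one, fun i => i.elim0⟩

theorem IsDefectiveIdentity.bordered_one {D : Matrix (Fin n) (Fin m) ℤ}
    (hD : IsDefectiveIdentity D) : IsDefectiveIdentity (bordered 1 0 0 D) := by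
  refine ⟨fun i j => ?_, fun i j i' j' => ?_⟩
  · cases i using Fin.cases <;> cases j using Fin.cases <;> simp [hD.1]
  · cases i using Fin.cases <;> cases j using Fin.cases <;> cases i' using Fin.cases <;>
      cases j' using Fin.cases <;> first | simp; done | simpa using hD.2 _ _ _ _

theorem IsDefectiveIdentity.transpose {D : Matrix (Fin n) (Fin m) ℤ}
    (hD : IsDefectiveIdentity D) : IsDefectiveIdentity D.transpose :=
  ⟨fun i j => hD.1 j i, fun i j i' j' h h' => (hD.2 j i j' i' h h').imp And.symm
    (Or.imp And.symm And.symm)⟩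

theorem IsDefectiveIdentity.consZeroRow {D : Matrix (Fin n) (Fin m) ℤ}
    (hD : IsDefectiveIdentity D) :
    IsDefectiveIdentity (consZeroRow D) := by
  refine ⟨fun i j => ?_, fun i j i' j' => ?_⟩
  · cases i using Fin.cases <;> simp [hD.1]
  · cases i using Fin.cases <;> cases i' using Fin.cases <;>
      first | simp; done | simpa using hD.2 _ _ _ _

theorem IsDefectiveIdentity.hasUnitEntries {D : Matrix (Fin n) (Fin m) ℤ}
    (hD : IsDefectiveIdentity D) : HasUnitEntries D := fun i j => (hD.1 i j).imp_right Or.inl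

end BorderedMatrices

section HasUnitFactorization

variable {n m : ℕ} {A : Matrix (Fin n) (Fin m) ℤ}

/-- The matrix `A` is a product `L * D * U` as in the theorem. -/
def HasUnitFactorization (A : Matrix (Fin n) (Fin m) ℤ) : Prop :=
  ∃ (L : Matrix (Fin n) (Fin n) ℤ) (D : Matrix (Fin n) (Fin m) ℤ) (U : Matrix (Fin m) (Fin m) ℤ),
    A = L * D * U ∧ IsUnitLowerTriangular L ∧ IsUnitLowerTriangular U.transpose ∧
      IsDefectiveIdentity D

namespace HasUnitFactorization

theorem transpose (h : HasUnitFactorization A) : HasUnitFactorization A.transpose := by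
  obtain ⟨L, D, U, rfl, hL, hU, hD⟩ := h
  refine ⟨U.transpose, D.transpose, L.transpose, ?_, hU, by simpa using hL, hD.transpose⟩
  simp [Matrix.transpose_mul, Matrix.mul_assoc]

theorem diagonal_mul (h : HasUnitFactorization A) {ε : Fin n → ℤ}
    (hε : ∀ i, ε i = 1 ∨ ε i = -1) : HasUnitFactorization (Matrix.diagonal ε * A) := by
  obtain ⟨L, D, U, rfl, hL, hU, hD⟩ := h
  exact ⟨_, D, U, by simp only [Matrix.mul_assoc], hL.diagonal_mul hε, hU, hD⟩

theorem bordered_of_sub {r : Fin m → ℤ} {c : Fin n → ℤ} (hr : ∀ j, r j = 0 ∨ r j = 1 ∨ r j = -1)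
    (hc : ∀ i, c i = 0 ∨ c i = 1 ∨ c i = -1)
    (h : HasUnitFactorization (A - Matrix.vecMulVec c r)) :
    HasUnitFactorization (bordered 1 r c A) := by
  obtain ⟨L, D, U, hLDU, hL, hU, hD⟩ := h
  refine ⟨_, _, bordered 1 r 0 U, ?_, hL.bordered_one hc, ?_, hD.bordered_one⟩
  · rw [bordered_mul_bordered_mul_bordered, ← hLDU, add_sub_cancel]
  · rw [bordered_transpose]
    exact hU.bordered_one hr

theorem consZeroRow (h : HasUnitFactorization A) :
    HasUnitFactorization (consZeroRow A) := by
  obtain ⟨L, D, U, rfl, hL, hU, hD⟩ := h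
  refine ⟨_, _, U, ?_, hL.bordered_one (c := 0) (by simp), hU, hD.consZeroRow⟩
  ext i j
  cases i using Fin.cases <;> simp [Matrix.mul_apply, Fin.sum_univ_succ]

end HasUnitFactorization

end HasUnitFactorization

/-- For some ordering of the rows in `P` and of the columns in `Q`, the restriction of the matrix
`M` to them has a factorization as in the theorem. -/
def FactorsOn {R C : Type*} (M : R → C → ℤ) (P : Finset R) (Q : Finset C) : Prop :=
  ∃ (b w : ℕ) (β : Fin b → R) (ω : Fin w → C), Function.Injective β ∧ Set.range β = P ∧
    Function.Injective ω ∧ Set.range ω = Q ∧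
      HasUnitFactorization (Matrix.of fun i j => M (β i) (ω j))

theorem injective_cons_and_range_cons {α : Type*} [DecidableEq α] {P : Finset α} {n : ℕ}
    {β : Fin n → α} {a : α} (ha : a ∈ P) (hβ : Function.Injective β)
    (hrange : Set.range β = (P.erase a : Finset α)) :
    Function.Injective (Fin.cons a β : Fin (n + 1) → α) ∧
      Set.range (Fin.cons a β : Fin (n + 1) → α) = P :=
  ⟨Fin.cons_injective_iff.mpr ⟨by simp [hrange], hβ⟩, by
    rw [Fin.range_cons, hrange, ← Finset.coe_insert, Finset.insert_erase ha]⟩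

namespace FactorsOn

variable {R C : Type*} {M M' : R → C → ℤ} {P : Finset R} {Q : Finset C}

theorem congr (h : FactorsOn M P Q) (hM : ∀ x ∈ P, ∀ y ∈ Q, M' x y = M x y) :
    FactorsOn M' P Q := by
  obtain ⟨b, w, β, ω, hβ, hP, hω, hQ, h⟩ := h
  refine ⟨b, w, β, ω, hβ, hP, hω, hQ, ?_⟩
  convert h using 4 with i j
  exact hM _ (Finset.mem_coe.mp (hP ▸ Set.mem_range_self i)) _
    (Finset.mem_coe.mp (hQ ▸ Set.mem_range_self j))

theorem exists_equiv {p : R → Prop} {q : C → Prop} (h : FactorsOn M P Q) (hP : ∀ x, x ∈ P ↔ p x)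
    (hQ : ∀ y, y ∈ Q ↔ q y) :
    ∃ (b w : ℕ) (β : Fin b ≃ {x // p x}) (ω : Fin w ≃ {y // q y}),
      HasUnitFactorization (Matrix.of fun i j => M (β i) (ω j)) := by
  obtain ⟨b, w, β, ω, hβ, hβP, hω, hωQ, hM⟩ := h
  refine ⟨b, w, (Equiv.ofInjective β hβ).trans (Equiv.subtypeEquivRight fun x => ?_),
    (Equiv.ofInjective ω hω).trans (Equiv.subtypeEquivRight fun y => ?_), hM⟩
  · rw [hβP, Finset.mem_coe, hP]
  · rw [hωQ, Finset.mem_coe, hQ]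

theorem empty : FactorsOn M ∅ ∅ :=
  ⟨0, 0, Fin.elim0, Fin.elim0, fun i => i.elim0, by simp, fun i => i.elim0, by simp, 1, 0, 1,
    Subsingleton.elim _ _, isUnitLowerTriangular_zero _, isUnitLowerTriangular_zero _,
    fun i => i.elim0, fun i => i.elim0⟩

theorem transpose (h : FactorsOn M P Q) : FactorsOn (fun y x => M x y) Q P := by
  obtain ⟨b, w, β, ω, hβ, hP, hω, hQ, h⟩ := h
  exact ⟨w, b, ω, β, hω, hQ, hβ, hP, h.transpose⟩

theorem scale_rows (h : FactorsOn M P Q) {ε : R → ℤ} (hε : ∀ x, ε x = 1 ∨ ε x = -1) :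
    FactorsOn (fun x y => ε x * M x y) P Q := by
  obtain ⟨b, w, β, ω, hβ, hP, hω, hQ, h⟩ := h
  refine ⟨b, w, β, ω, hβ, hP, hω, hQ, ?_⟩
  convert h.diagonal_mul (fun i => hε (β i)) using 1
  ext i j
  simp [Matrix.diagonal_mul]

theorem scale_cols (h : FactorsOn M P Q) {δ : C → ℤ} (hδ : ∀ y, δ y = 1 ∨ δ y = -1) :
    FactorsOn (fun x y => δ y * M x y) P Q :=
  (h.transpose.scale_rows hδ).transpose

theorem pivot [DecidableEq R] [DecidableEq C] {r : R} {c : C} (hr : r ∈ P) (hc : c ∈ Q)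
    (hrc : M r c = 1) (hcol : ∀ x ∈ P, M x c = 0 ∨ M x c = 1 ∨ M x c = -1)
    (hrow : ∀ y ∈ Q, M r y = 0 ∨ M r y = 1 ∨ M r y = -1)
    (h : FactorsOn (fun x y => M x y - M x c * M r y) (P.erase r) (Q.erase c)) :
    FactorsOn M P Q := by
  obtain ⟨b, w, β, ω, hβ, hP, hω, hQ, h⟩ := h
  have hβP : ∀ i, β i ∈ P := fun i =>
    Finset.mem_of_mem_erase (Finset.mem_coe.mp (hP ▸ Set.mem_range_self i))
  have hωQ : ∀ j, ω j ∈ Q := fun j =>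
    Finset.mem_of_mem_erase (Finset.mem_coe.mp (hQ ▸ Set.mem_range_self j))
  obtain ⟨hβ', hP'⟩ := injective_cons_and_range_cons hr hβ hP
  obtain ⟨hω', hQ'⟩ := injective_cons_and_range_cons hc hω hQ
  refine ⟨b + 1, w + 1, _, _, hβ', hP', hω', hQ', ?_⟩
  convert HasUnitFactorization.bordered_of_sub (A := Matrix.of fun i j => M (β i) (ω j))
    (fun j => hrow _ (hωQ j)) (fun i => hcol _ (hβP i)) h using 1
  ext i j
  cases i using Fin.cases <;> cases j using Fin.cases <;> simp [hrc]

theorem zero_row [DecidableEq R] {r : R} (hr : r ∈ P) (hrow : ∀ y ∈ Q, M r y = 0)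
    (h : FactorsOn M (P.erase r) Q) : FactorsOn M P Q := by
  obtain ⟨b, w, β, ω, hβ, hP, hω, hQ, h⟩ := h
  obtain ⟨hβ', hP'⟩ := injective_cons_and_range_cons hr hβ hP
  refine ⟨b + 1, w, _, ω, hβ', hP', hω, hQ, ?_⟩
  convert h.consZeroRow using 1
  ext i j
  have hj : M r (ω j) = 0 := hrow _ (Finset.mem_coe.mp (hQ ▸ Set.mem_range_self j))
  cases i using Fin.cases <;> simp [hj]

theorem zero_col [DecidableEq C] {c : C} (hc : c ∈ Q) (hcol : ∀ x ∈ P, M x c = 0)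
    (h : FactorsOn M P (Q.erase c)) : FactorsOn M P Q :=
  (h.transpose.zero_row hc hcol).transpose

end FactorsOn

section ExactGrid

variable {S : Type*} {E N : S → S → Prop}

/-- The squares `s`, `t`, `x`, `y` surround a vertex, to its south-west, south-east, north-east and
north-west, respectively; `E s t` says that `t` is the eastern neighbor of `s`, and `N s t` that it
is the northern one. -/
def IsBlock (E N : S → S → Prop) (s t x y : S) : Prop :=
  E s t ∧ N t x ∧ N s y ∧ E y x

/-- Squares with eastern and northern neighbors, such that every cochain on pairs of neighbors
that is closed on blocks is exact: the combinatorial form of simple connectedness. -/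
structure IsExactGrid (E N : S → S → Prop) : Prop where
  east : Relator.BiUnique E
  north : Relator.BiUnique N
  exact : ∀ (A : Type) [AddCommGroup A] (f g : S → S → A),
    (∀ s t x y, IsBlock E N s t x y → f s t + g t x = g s y + f y x) →
    ∃ h : S → A, (∀ s t, E s t → f s t = h t - h s) ∧ ∀ s t, N s t → g s t = h t - h s

/-- The relation `r` after the deletion of the square `t`. -/
def Without (t : S) (r : S → S → Prop) (a b : S) : Prop := r a b ∧ a ≠ t ∧ b ≠ t

theorem exists_const_of_forall_eq {α A : Type*} [Nonempty A] {p : α → Prop} {F : α → A}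
    (h : ∀ a b, p a → p b → F a = F b) : ∃ c, ∀ a, p a → F a = c := by
  by_cases hp : ∃ a, p a
  · exact hp.imp' F fun a ha b hb => h b a hb ha
  · exact ‹Nonempty A›.elim fun c => ⟨c, fun a ha => absurd ⟨a, ha⟩ hp⟩

namespace IsExactGrid

theorem swap (G : IsExactGrid E N) : IsExactGrid N E where
  east := G.north
  north := G.east
  exact A _ f g H := by
    obtain ⟨h, hE, hN⟩ := G.exact A g f fun s t x y ⟨hst, htx, hsy, hyx⟩ =>
      (H s y x t ⟨hsy, hyx, hst, htx⟩).symm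
    exact ⟨h, hN, hE⟩

theorem reverse (G : IsExactGrid E N) : IsExactGrid (flip E) (flip N) where
  east := ⟨fun _ _ _ h h' => G.east.2 h h', fun _ _ _ h h' => G.east.1 h h'⟩
  north := ⟨fun _ _ _ h h' => G.north.2 h h', fun _ _ _ h h' => G.north.1 h h'⟩
  exact A _ f g H := by
    obtain ⟨h, hE, hN⟩ := G.exact A (fun s t => f t s) (fun s t => g t s)
      fun s t x y ⟨hst, htx, hsy, hyx⟩ => by
        rw [add_comm, ← H x y s t ⟨hyx, hsy, htx, hst⟩, add_comm]
    exact ⟨fun s => -h s, fun s t hst => (hE t s hst).trans (neg_sub_neg _ _).symm,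
      fun s t hst => (hN t s hst).trans (neg_sub_neg _ _).symm⟩

theorem exists_position (G : IsExactGrid E N) : ∃ X Y : S → ℤ,
    (∀ s t, E s t → X t = X s + 1 ∧ Y t = Y s) ∧ ∀ s t, N s t → X t = X s ∧ Y t = Y s + 1 := by
  obtain ⟨X, hXE, hXN⟩ := G.exact ℤ (fun _ _ => 1) (fun _ _ => 0) (by simp)
  obtain ⟨Y, hYE, hYN⟩ := G.exact ℤ (fun _ _ => 0) (fun _ _ => 1) (by simp)
  refine ⟨X, Y, fun s t hst => ⟨?_, ?_⟩, fun s t hst => ⟨?_, ?_⟩⟩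
  · linarith [hXE s t hst]
  · linarith [hYE s t hst]
  · linarith [hXN s t hst]
  · linarith [hYN s t hst]

theorem ne_of_east (G : IsExactGrid E N) {a b : S} (h : E a b) : a ≠ b := by
  rintro rfl
  obtain ⟨X, Y, hE, -⟩ := G.exists_position
  exact (lt_add_one (X a)).ne (hE a a h).1

theorem ne_of_north (G : IsExactGrid E N) {a b : S} (h : N a b) : a ≠ b :=
  G.swap.ne_of_east h

theorem block_unique_of_southWest (G : IsExactGrid E N) {s t x y t' x' y' : S}
    (h : IsBlock E N s t x y) (h' : IsBlock E N s t' x' y') : t = t' ∧ x = x' ∧ y = y' := by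
  obtain rfl := G.east.2 h.1 h'.1
  exact ⟨rfl, G.north.2 h.2.1 h'.2.1, G.north.2 h.2.2.1 h'.2.2.1⟩

theorem block_unique_of_southEast (G : IsExactGrid E N) {s t x y s' x' y' : S}
    (h : IsBlock E N s t x y) (h' : IsBlock E N s' t x' y') : s = s' ∧ x = x' ∧ y = y' := by
  obtain rfl := G.east.1 h.1 h'.1
  exact ⟨rfl, (G.block_unique_of_southWest h h').2⟩

theorem block_unique_of_northEast (G : IsExactGrid E N) {s t x y s' t' y' : S}
    (h : IsBlock E N s t x y) (h' : IsBlock E N s' t' x y') : s = s' ∧ t = t' ∧ y = y' := by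
  obtain rfl := G.north.1 h.2.1 h'.2.1
  obtain ⟨rfl, -, rfl⟩ := G.block_unique_of_southEast h h'
  exact ⟨rfl, rfl, rfl⟩

theorem block_unique_of_northWest (G : IsExactGrid E N) {s t x y s' t' x' : S}
    (h : IsBlock E N s t x y) (h' : IsBlock E N s' t' x' y) : s = s' ∧ t = t' ∧ x = x' := by
  obtain rfl := G.north.1 h.2.2.1 h'.2.2.1
  obtain ⟨rfl, rfl, -⟩ := G.block_unique_of_southWest h h'
  exact ⟨rfl, rfl, rfl⟩

/-- A closed cochain on the remaining grid is extended by `0` to the eastern neighbor of `t`; its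
values on the northern and southern neighbors of `t` are then forced by the blocks there. -/
theorem delete_of_not_west (G : IsExactGrid E N) {t : S} (ht : ∀ x, ¬ E x t) :
    IsExactGrid (Without t E) (Without t N) where
  east := ⟨fun _ _ _ h h' => G.east.1 h.1 h'.1, fun _ _ _ h h' => G.east.2 h.1 h'.1⟩
  north := ⟨fun _ _ _ h h' => G.north.1 h.1 h'.1, fun _ _ _ h h' => G.north.2 h.1 h'.1⟩
  exact A _ f g H := by
    classical
    obtain ⟨cN, hcN⟩ : ∃ c, ∀ p : S × S × S, IsBlock E N t p.1 p.2.1 p.2.2 →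
        g p.1 p.2.1 - f p.2.2 p.2.1 = c := exists_const_of_forall_eq fun p p' h h' => by
      obtain ⟨h₁, h₂, h₃⟩ := G.block_unique_of_southWest h h'
      rw [h₁, h₂, h₃]
    obtain ⟨cS, hcS⟩ : ∃ c, ∀ p : S × S × S, IsBlock E N p.1 p.2.1 p.2.2 t →
        f p.1 p.2.1 + g p.2.1 p.2.2 = c := exists_const_of_forall_eq fun p p' h h' => by
      obtain ⟨h₁, h₂, h₃⟩ := G.block_unique_of_northWest h h'
      rw [h₁, h₂, h₃]
    obtain ⟨h, hE, hN⟩ := G.exact A (fun a b => if a = t then 0 else f a b)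
      (fun a b => if a = t then cN else if b = t then cS else g a b) fun s q x y hb => by
        obtain ⟨hsq, hqx, hsy, hyx⟩ := id hb
        have hq : q ≠ t := fun h => ht s (h ▸ hsq)
        have hx : x ≠ t := fun h => ht y (h ▸ hyx)
        have hsy' : s ≠ y := G.ne_of_north hsy
        by_cases hs : s = t
        · subst hs
          simp only [if_true, if_neg hq, if_neg hx, if_neg hsy'.symm]
          rw [zero_add, ← hcN (q, x, y) hb, sub_add_cancel]
        by_cases hy : y = t
        · subst hy
          simp only [if_true, if_neg hq, if_neg hx, if_neg hs]
          rw [add_zero, hcS (s, q, x) hb]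
        · simp only [if_neg hs, if_neg hq, if_neg hx, if_neg hy]
          exact H s q x y ⟨⟨hsq, hs, hq⟩, ⟨hqx, hq, hx⟩, ⟨hsy, hs, hy⟩, ⟨hyx, hy, hx⟩⟩
    refine ⟨h, fun a b hab => ?_, fun a b hab => ?_⟩
    · rw [← hE a b hab.1, if_neg hab.2.1]
    · rw [← hN a b hab.1, if_neg hab.2.1, if_neg hab.2.2]

end IsExactGrid

end ExactGrid

section EulerCharacteristic

theorem finrank_lt_of_ker_le_range {K U W Z : Type*} [Field K] [AddCommGroup U] [AddCommGroup W]
    [AddCommGroup Z] [Module K U] [Module K W] [Module K Z] [FiniteDimensional K U]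
    [FiniteDimensional K W] [FiniteDimensional K Z] {d₀ : U →ₗ[K] W} {d₁ : W →ₗ[K] Z}
    (hker : LinearMap.ker d₁ ≤ LinearMap.range d₀) (hd₀ : LinearMap.ker d₀ ≠ ⊥) :
    Module.finrank K W < Module.finrank K U + Module.finrank K Z := by
  have hpos : 0 < Module.finrank K (LinearMap.ker d₀) :=
    Nat.pos_of_ne_zero fun h => hd₀ (Submodule.finrank_eq_zero.mp h)
  have hU := d₀.finrank_range_add_finrank_ker
  have hW := d₁.finrank_range_add_finrank_ker
  have hle := Submodule.finrank_mono hker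
  have hZ := Submodule.finrank_le (LinearMap.range d₁)
  omega

theorem card_edges_lt_of_exact {V D F : Type*} [Fintype V] [Fintype D] [Fintype F] [Nonempty V]
    {src tgt : D → V} {a b c d : F → D}
    (exact : ∀ f : D → ℚ, (∀ z, f (a z) + f (b z) = f (c z) + f (d z)) →
      ∃ h : V → ℚ, ∀ e, f e = h (tgt e) - h (src e)) :
    Fintype.card D < Fintype.card V + Fintype.card F := by
  have hker : LinearMap.ker (LinearMap.funLeft ℚ ℚ a + LinearMap.funLeft ℚ ℚ b -
      (LinearMap.funLeft ℚ ℚ c + LinearMap.funLeft ℚ ℚ d)) ≤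
      LinearMap.range (LinearMap.funLeft ℚ ℚ tgt - LinearMap.funLeft ℚ ℚ src) := fun f hf => by
    obtain ⟨h, hh⟩ := exact f fun z => sub_eq_zero.mp (congrFun (LinearMap.mem_ker.mp hf) z)
    exact ⟨h, funext fun e => (hh e).symm⟩
  have hconst : LinearMap.ker (LinearMap.funLeft ℚ ℚ tgt - LinearMap.funLeft ℚ ℚ src) ≠ ⊥ :=
    (Submodule.ne_bot_iff _).mpr ⟨1, funext fun _ => sub_self 1, one_ne_zero⟩
  simpa only [Module.finrank_fintype_fun_eq_card] using finrank_lt_of_ker_le_range hker hconst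

variable {S : Type*} {E N : S → S → Prop} {V : Finset S}

namespace IsExactGrid

open Classical in
theorem card_east_add_card_north_lt (G : IsExactGrid E N) (hV : V.Nonempty)
    (hE : ∀ s t, E s t → s ∈ V ∧ t ∈ V) (hN : ∀ s t, N s t → s ∈ V ∧ t ∈ V) :
    (V.filter fun s => ∃ t, E s t).card + (V.filter fun s => ∃ t, N s t).card <
      V.card + (V.filter fun s => ∃ t x y, IsBlock E N s t x y).card := by
  let HE := V.filter fun s => ∃ t, E s t
  let HN := V.filter fun s => ∃ t, N s t
  let HB := V.filter fun s => ∃ t x y, IsBlock E N s t x y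
  have : Nonempty V := hV.to_subtype
  have memE : ∀ {s t}, E s t → s ∈ HE := fun h => Finset.mem_filter.mpr ⟨(hE _ _ h).1, _, h⟩
  have memN : ∀ {s t}, N s t → s ∈ HN := fun h => Finset.mem_filter.mpr ⟨(hN _ _ h).1, _, h⟩
  choose e he using fun s : HE => (Finset.mem_filter.mp s.2).2
  choose n hn using fun s : HN => (Finset.mem_filter.mp s.2).2
  choose t x y hb using fun s : HB => (Finset.mem_filter.mp s.2).2
  have key : Fintype.card (HE ⊕ HN) < Fintype.card V + Fintype.card HB :=
    card_edges_lt_of_exact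
      (src := Sum.elim (fun s => ⟨s, (hE _ _ (he s)).1⟩) fun s => ⟨s, (hN _ _ (hn s)).1⟩)
      (tgt := Sum.elim (fun s => ⟨e s, (hE _ _ (he s)).2⟩) fun s => ⟨n s, (hN _ _ (hn s)).2⟩)
      (a := fun s => .inl ⟨s, memE (hb s).1⟩) (b := fun s => .inr ⟨t s, memN (hb s).2.1⟩)
      (c := fun s => .inr ⟨s, memN (hb s).2.2.1⟩) (d := fun s => .inl ⟨y s, memE (hb s).2.2.2⟩)
      fun f hf => by
        obtain ⟨h, hhE, hhN⟩ := G.exact ℚ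
          (fun s _ => if hs : s ∈ HE then f (.inl ⟨s, hs⟩) else 0)
          (fun s _ => if hs : s ∈ HN then f (.inr ⟨s, hs⟩) else 0) fun s t' x' y' hb' => by
            have hs : s ∈ HB := Finset.mem_filter.mpr ⟨(hE _ _ hb'.1).1, _, _, _, hb'⟩
            obtain ⟨rfl, rfl, rfl⟩ := G.block_unique_of_southWest (hb ⟨s, hs⟩) hb'
            simpa only [memE hb'.1, memN hb'.2.1, memN hb'.2.2.1, memE hb'.2.2.2, dif_pos]
              using hf ⟨s, hs⟩
        refine ⟨fun s => h s, Sum.rec (fun s => ?_) fun s => ?_⟩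
        · simpa using hhE s (e s) (he s)
        · simpa using hhN s (n s) (hn s)
  simpa only [Fintype.card_sum, Fintype.card_coe] using key

end IsExactGrid

open Classical in
/-- The squares whose north-eastern vertex is a corner of the boundary with three squares, the
reference square being to its south-west. -/
noncomputable def reflexCorners (E N : S → S → Prop) (V : Finset S) : Finset S :=
  V.filter fun s => (∃ t, E s t) ∧ (∃ t, N s t) ∧ ¬ ∃ t x y, IsBlock E N s t x y

open Classical in
/-- The squares whose north-eastern vertex belongs to no other square. -/
noncomputable def convexCorners (E N : S → S → Prop) (V : Finset S) : Finset S :=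
  V.filter fun s => (∀ t, ¬ E s t) ∧ ∀ t, ¬ N s t

theorem IsExactGrid.card_reflexCorners_lt_card_convexCorners (G : IsExactGrid E N)
    (hV : V.Nonempty) (hE : ∀ s t, E s t → s ∈ V ∧ t ∈ V) (hN : ∀ s t, N s t → s ∈ V ∧ t ∈ V) :
    (reflexCorners E N V).card < (convexCorners E N V).card := by
  classical
  have key := G.card_east_add_card_north_lt hV hE hN
  have hsum : (V.filter fun s => ∃ t, E s t).card + (V.filter fun s => ∃ t, N s t).card +
      (convexCorners E N V).card = V.card +
        (V.filter fun s => ∃ t x y, IsBlock E N s t x y).card + (reflexCorners E N V).card := by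
    simp only [convexCorners, reflexCorners, Finset.card_filter, Finset.card_eq_sum_ones V,
      ← Finset.sum_add_distrib]
    refine Finset.sum_congr rfl fun s _ => ?_
    have hblock : (∃ t x y, IsBlock E N s t x y) → (∃ t, E s t) ∧ ∃ t, N s t :=
      fun ⟨t, x, y, h⟩ => ⟨⟨t, h.1⟩, y, h.2.2.1⟩
    simp only [← not_exists]
    by_cases h₁ : ∃ t x y, IsBlock E N s t x y
    · simp [h₁, hblock h₁]
    · by_cases h₂ : ∃ t, E s t <;> by_cases h₃ : ∃ t, N s t <;> simp [h₁, h₂, h₃]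
  omega

end EulerCharacteristic

section Diagonal

variable {S : Type*} {E N : S → S → Prop} {V : Finset S}

/-- The step from a square to the diagonally opposite one of a block, in the north-east
direction. -/
def DiagonalStep (E N : S → S → Prop) (s x : S) : Prop := ∃ t y, IsBlock E N s t x y

theorem IsExactGrid.exists_reflTransGen_diagonalStep (G : IsExactGrid E N)
    (hE : ∀ s t, E s t → s ∈ V ∧ t ∈ V) {a : S} (ha : a ∈ V) :
    ∃ b, Relation.ReflTransGen (DiagonalStep E N) a b ∧ ¬ ∃ t x y, IsBlock E N b t x y := by
  classical
  obtain ⟨X, Y, hX, hY⟩ := G.exists_position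
  obtain ⟨b, hb, hmax⟩ := Finset.exists_max_image
    (V.filter fun b => Relation.ReflTransGen (DiagonalStep E N) a b) X
    ⟨a, Finset.mem_filter.mpr ⟨ha, .refl⟩⟩
  have hab := (Finset.mem_filter.mp hb).2
  refine ⟨b, hab, fun ⟨t, x, y, h⟩ => ?_⟩
  have hxb := hmax x (Finset.mem_filter.mpr ⟨(hE _ _ h.2.2.2).2, hab.tail ⟨t, y, h⟩⟩)
  have htX := hX _ _ h.1
  have hxX := hY _ _ h.2.1
  omega

theorem IsExactGrid.eq_of_reflTransGen_diagonalStep (G : IsExactGrid E N) {a a' b : S}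
    (ha : ∀ x, ¬ E x a) (ha' : ∀ x, ¬ E x a')
    (h : Relation.ReflTransGen (DiagonalStep E N) a b)
    (h' : Relation.ReflTransGen (DiagonalStep E N) a' b) : a = a' := by
  have hunique : Relator.RightUnique (Function.swap (DiagonalStep E N)) :=
    fun _ _ _ ⟨_, _, hb⟩ ⟨_, _, hb'⟩ => (G.block_unique_of_northEast hb hb').1
  have hstart : ∀ c d, (∀ x, ¬ E x c) → Relation.ReflTransGen (DiagonalStep E N) d c → c = d :=
    fun c d hc hdc => hdc.cases_tail.resolve_right fun ⟨_, _, _, _, hb⟩ => hc _ hb.2.2.2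
  rw [← Relation.reflTransGen_swap] at h h'
  rcases Relation.ReflTransGen.total_of_right_unique hunique h h' with h | h <;>
    rw [Relation.reflTransGen_swap] at h
  · exact hstart _ _ ha h
  · exact (hstart _ _ ha' h).symm

theorem exists_seq_of_reflTransGen {α : Type*} {r : α → α → Prop} {a b : α}
    (h : Relation.ReflTransGen r a b) :
    ∃ (m : ℕ) (s : ℕ → α), s 0 = a ∧ s m = b ∧ ∀ i < m, r (s i) (s (i + 1)) := by
  induction h using Relation.ReflTransGen.head_induction_on with
  | refl => exact ⟨0, fun _ => b, rfl, rfl, by simp⟩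
  | @head a c hac _ ih =>
    obtain ⟨m, s, rfl, hm, hs⟩ := ih
    exact ⟨m + 1, fun | 0 => a | i + 1 => s i, rfl, hm,
      Nat.rec (fun _ => hac) fun i _ hi => hs i (by omega)⟩

/-- The squares `s 0, …, s m` form a diagonal of an exact grid, in the north-east direction, which
starts at a convex corner and does not end at a reflex one; `u i` and `t i` are the eastern and the
northern neighbors of `s i`, for `i < m`. -/
structure IsGoodDiagonal (E N : S → S → Prop) (m : ℕ) (s t u : ℕ → S) : Prop
    extends IsExactGrid E N where
  block : ∀ i < m, IsBlock E N (s i) (u i) (s (i + 1)) (t i)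
  not_west : ∀ x, ¬ E x (s 0)
  not_south : ∀ x, ¬ N x (s 0)
  not_north : ∀ x, ¬ N (s m) x

theorem IsExactGrid.exists_isGoodDiagonal_of_reflTransGen (G : IsExactGrid E N) {a b : S}
    (hab : Relation.ReflTransGen (DiagonalStep E N) a b) (hE : ∀ x, ¬ E x a) (hN : ∀ x, ¬ N x a)
    (hb : (∀ x, ¬ N b x) ∨ ∀ x, ¬ E b x) :
    ∃ m s t u, s 0 = a ∧ (IsGoodDiagonal E N m s t u ∨ IsGoodDiagonal N E m s t u) := by
  obtain ⟨m, s, rfl, rfl, hs⟩ := exists_seq_of_reflTransGen hab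
  have : ∀ i, ∃ u t, i < m → IsBlock E N (s i) u (s (i + 1)) t := fun i => by
    by_cases hi : i < m
    · exact (hs i hi).imp fun u ⟨t, h⟩ => ⟨t, fun _ => h⟩
    · exact ⟨s i, s i, fun h => absurd h hi⟩
  choose u t h using this
  rcases hb with hb | hb
  · exact ⟨m, s, t, u, rfl, .inl ⟨G, h, hE, hN, hb⟩⟩
  · exact ⟨m, s, u, t, rfl, .inr ⟨G.swap, fun i hi =>
      ⟨(h i hi).2.2.1, (h i hi).2.2.2, (h i hi).1, (h i hi).2.1⟩, hN, hE, hb⟩⟩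

theorem IsExactGrid.exists_isGoodDiagonal_of_card_lt (G : IsExactGrid E N)
    (hE : ∀ s t, E s t → s ∈ V ∧ t ∈ V)
    (hcard : (reflexCorners E N V).card < (convexCorners (flip E) (flip N) V).card) :
    ∃ m s t u, s 0 ∈ V ∧ (IsGoodDiagonal E N m s t u ∨ IsGoodDiagonal N E m s t u) := by
  classical
  suffices ∃ a b, a ∈ V ∧ (∀ x, ¬ E x a) ∧ (∀ x, ¬ N x a) ∧
      Relation.ReflTransGen (DiagonalStep E N) a b ∧ ((∀ x, ¬ N b x) ∨ ∀ x, ¬ E b x) by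
    obtain ⟨a, b, ha, hEa, hNa, hab, hb⟩ := this
    obtain ⟨m, s, t, u, rfl, h⟩ := G.exists_isGoodDiagonal_of_reflTransGen hab hEa hNa hb
    exact ⟨m, s, t, u, ha, h⟩
  by_contra! hcon
  have hstart : ∀ a ∈ convexCorners (flip E) (flip N) V,
      a ∈ V ∧ (∀ x, ¬ E x a) ∧ ∀ x, ¬ N x a := fun a ha => Finset.mem_filter.mp ha
  have hend : ∀ a, ∃ b, a ∈ convexCorners (flip E) (flip N) V →
      Relation.ReflTransGen (DiagonalStep E N) a b ∧ b ∈ reflexCorners E N V := fun a => by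
    by_cases ha : a ∈ convexCorners (flip E) (flip N) V
    · obtain ⟨haV, hEa, hNa⟩ := hstart a ha
      obtain ⟨b, hab, hb⟩ := G.exists_reflTransGen_diagonalStep hE haV
      obtain ⟨hNb, x, hEb⟩ := hcon a b haV hEa hNa hab
      exact ⟨b, fun _ => ⟨hab, Finset.mem_filter.mpr ⟨(hE b x hEb).1, ⟨x, hEb⟩, hNb, hb⟩⟩⟩
    · exact ⟨a, fun h => absurd h ha⟩
  choose φ hφ using hend
  obtain ⟨a, ha, a', ha', hne, heq⟩ :=
    Finset.exists_ne_map_eq_of_card_lt_of_maps_to hcard fun a ha => (hφ a ha).2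
  exact hne (G.eq_of_reflTransGen_diagonalStep (hstart a ha).2.1 (hstart a' ha').2.1
    (hφ a ha).1 (heq ▸ (hφ a' ha').1))

/-- Towards the north-east and towards the south-west there are more convex corners than reflex
ones; hence, towards one of them, there are fewer reflex corners than opposite convex ones. -/
theorem IsExactGrid.exists_isGoodDiagonal (G : IsExactGrid E N) (hV : V.Nonempty)
    (hE : ∀ s t, E s t → s ∈ V ∧ t ∈ V) (hN : ∀ s t, N s t → s ∈ V ∧ t ∈ V) :
    ∃ m s t u, s 0 ∈ V ∧ (IsGoodDiagonal E N m s t u ∨ IsGoodDiagonal N E m s t u ∨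
      IsGoodDiagonal (flip E) (flip N) m s t u ∨ IsGoodDiagonal (flip N) (flip E) m s t u) := by
  have hE' : ∀ s t, flip E s t → s ∈ V ∧ t ∈ V := fun s t h => (hE t s h).symm
  have hN' : ∀ s t, flip N s t → s ∈ V ∧ t ∈ V := fun s t h => (hN t s h).symm
  have hlt := G.card_reflexCorners_lt_card_convexCorners hV hE hN
  have hlt' := G.reverse.card_reflexCorners_lt_card_convexCorners hV hE' hN'
  rcases lt_or_ge (reflexCorners E N V).card (convexCorners (flip E) (flip N) V).card with h | h
  · obtain ⟨m, s, t, u, hs, h⟩ := G.exists_isGoodDiagonal_of_card_lt hE h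
    exact ⟨m, s, t, u, hs, h.imp_right Or.inl⟩
  · obtain ⟨m, s, t, u, hs, h⟩ :=
      G.reverse.exists_isGoodDiagonal_of_card_lt hE' (hlt'.trans (h.trans_lt hlt))
    exact ⟨m, s, t, u, hs, .inr (.inr h)⟩

namespace IsGoodDiagonal

variable {m : ℕ} {s t u : ℕ → S}

theorem exists_position (D : IsGoodDiagonal E N m s t u) : ∃ X Y : S → ℤ,
    (∀ a b, E a b → X b = X a + 1 ∧ Y b = Y a) ∧ (∀ a b, N a b → X b = X a ∧ Y b = Y a + 1) ∧
    (∀ i ≤ m, X (s i) = i ∧ Y (s i) = i) ∧ (∀ i < m, X (t i) = i ∧ Y (t i) = i + 1) ∧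
    ∀ i < m, X (u i) = i + 1 ∧ Y (u i) = i := by
  obtain ⟨X, Y, hX, hY⟩ := D.toIsExactGrid.exists_position
  have hs : ∀ i ≤ m, X (s i) = X (s 0) + i ∧ Y (s i) = Y (s 0) + i := fun i => by
    induction i with
    | zero => simp
    | succ i ih =>
      intro hi
      have hsi := ih (by omega)
      have hu := hX _ _ (D.block i hi).1
      have hx := hY _ _ (D.block i hi).2.1
      push_cast
      omega
  refine ⟨fun a => X a - X (s 0), fun a => Y a - Y (s 0), fun a b hab => ?_, fun a b hab => ?_,
    fun i hi => ?_, fun i hi => ?_, fun i hi => ?_⟩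
  · have := hX a b hab
    dsimp only
    omega
  · have := hY a b hab
    dsimp only
    omega
  · have := hs i hi
    dsimp only
    omega
  · have hsi := hs i hi.le
    have := hY _ _ (D.block i hi).2.2.1
    dsimp only
    omega
  · have hsi := hs i hi.le
    have := hX _ _ (D.block i hi).1
    dsimp only
    omega

theorem s_injOn (D : IsGoodDiagonal E N m s t u) : Set.InjOn s (Set.Iic m) := by
  obtain ⟨X, Y, -, -, hs, -, -⟩ := D.exists_position
  intro i hi j hj hij
  have := congrArg X hij
  rw [(hs i hi).1, (hs j hj).1] at this
  exact_mod_cast this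

theorem t_injOn (D : IsGoodDiagonal E N m s t u) : Set.InjOn t (Set.Iio m) := by
  obtain ⟨X, Y, -, -, -, ht, -⟩ := D.exists_position
  intro i hi j hj hij
  have := congrArg X hij
  rw [(ht i hi).1, (ht j hj).1] at this
  exact_mod_cast this

theorem u_injOn (D : IsGoodDiagonal E N m s t u) : Set.InjOn u (Set.Iio m) := by
  obtain ⟨X, Y, -, -, -, -, hu⟩ := D.exists_position
  intro i hi j hj hij
  have := congrArg Y hij
  rw [(hu i hi).2, (hu j hj).2] at this
  exact_mod_cast this

theorem t_ne_s (D : IsGoodDiagonal E N m s t u) {i j : ℕ} (hi : i < m) (hj : j ≤ m) :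
    t i ≠ s j := fun h => by
  obtain ⟨X, Y, -, -, hs, ht, -⟩ := D.exists_position
  have := ht i hi
  rw [h, (hs j hj).1, (hs j hj).2] at this
  omega

theorem u_ne_s (D : IsGoodDiagonal E N m s t u) {i j : ℕ} (hi : i < m) (hj : j ≤ m) :
    u i ≠ s j := fun h => by
  obtain ⟨X, Y, -, -, hs, -, hu⟩ := D.exists_position
  have := hu i hi
  rw [h, (hs j hj).1, (hs j hj).2] at this
  omega

theorem t_ne_u (D : IsGoodDiagonal E N m s t u) {i j : ℕ} (hi : i < m) (hj : j < m) :
    t i ≠ u j := fun h => by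
  obtain ⟨X, Y, -, -, -, ht, hu⟩ := D.exists_position
  have := ht i hi
  rw [h, (hu j hj).1, (hu j hj).2] at this
  omega

theorem exists_eq_t_of_east (D : IsGoodDiagonal E N m s t u) {x : S} {j : ℕ} (hj : j ≤ m)
    (h : E x (s j)) : ∃ i < m, j = i + 1 ∧ x = t i := by
  cases j with
  | zero => exact absurd h (D.not_west x)
  | succ i => exact ⟨i, hj, rfl, D.east.1 h (D.block i hj).2.2.2⟩

theorem exists_eq_u_of_north (D : IsGoodDiagonal E N m s t u) {x : S} {j : ℕ} (hj : j ≤ m)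
    (h : N x (s j)) : ∃ i < m, j = i + 1 ∧ x = u i := by
  cases j with
  | zero => exact absurd h (D.not_south x)
  | succ i => exact ⟨i, hj, rfl, D.north.1 h (D.block i hj).2.1⟩

end IsGoodDiagonal

end Diagonal

section Zip

variable {S : Type*} {E N r : S → S → Prop} {m : ℕ} {s t u : ℕ → S}

/-- The identification of the squares `t i` with the squares `u i`, for `i < m`. -/
noncomputable def zip (m : ℕ) (t u : ℕ → S) : S → S :=
  Function.extend (fun i : Fin m => t i) (fun i => u i) id

/-- The relation `r` without the pairs that start in `s 0, …, s (m - 1)` or end in `s 0, …, s m`: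
the squares `s i` with `i < m` are deleted, and `s m` is separated from its western and southern
neighbors. -/
def Cut (m : ℕ) (s : ℕ → S) (r : S → S → Prop) (a b : S) : Prop :=
  r a b ∧ (∀ i < m, a ≠ s i) ∧ ∀ i ≤ m, b ≠ s i

/-- The neighbors after the grid has been cut open along the diagonal `s` and the two banks `t` and
`u` of the cut have been zipped together. -/
def Zipped (m : ℕ) (s t u : ℕ → S) (r : S → S → Prop) : S → S → Prop :=
  Relation.Map (Cut m s r) (zip m t u) (zip m t u)

theorem zip_of_ne {x : S} (hx : ∀ i < m, x ≠ t i) : zip m t u x = x :=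
  Function.extend_apply' _ _ _ fun ⟨i, hi⟩ => hx i i.2 hi.symm

theorem Cut.zipped {a b : S} (h : Cut m s r a b) :
    Zipped m s t u r (zip m t u a) (zip m t u b) :=
  ⟨a, b, h, rfl, rfl⟩

theorem cut_biUnique (hr : Relator.BiUnique r) : Relator.BiUnique (Cut m s r) :=
  ⟨fun _ _ _ h h' => hr.1 h.1 h'.1, fun _ _ _ h h' => hr.2 h.1 h'.1⟩

theorem Cut.of_notMem {a b : S} (h : r a b) (ha : ¬ ∃ j ≤ m, a = s j) (hb : ¬ ∃ j ≤ m, b = s j) :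
    Cut m s r a b :=
  ⟨h, fun j hj hj' => ha ⟨j, hj.le, hj'⟩, fun j hj hj' => hb ⟨j, hj, hj'⟩⟩

theorem exists_const_of_forall_eq₂ {α β B : Type*} [Nonempty B] {p : α → Prop} {q : β → Prop}
    {F : α → B} {F' : β → B} (hF : ∀ a a', p a → p a' → F a = F a')
    (hF' : ∀ b b', q b → q b' → F' b = F' b') (h : ∀ a b, p a → q b → F a = F' b) :
    ∃ c, (∀ a, p a → F a = c) ∧ ∀ b, q b → F' b = c := by
  obtain ⟨c, hc⟩ := exists_const_of_forall_eq (p := Sum.elim p q) (F := Sum.elim F F') (by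
    rintro (a | b) (a' | b') ha hb
    exacts [hF a a' ha hb, h a b' ha hb, (h a' b hb ha).symm, hF' b b' ha hb])
  exact ⟨c, fun a => hc (.inl a), fun b => hc (.inr b)⟩

/-- A cochain `f` after the zipping, extended to the deleted pairs: by `c` on the pairs that end on
the diagonal, and by `0` on the other ones. -/
noncomputable def unzip {A : Type*} [Zero A] (m : ℕ) (s t u : ℕ → S) (c : S → A) (f : S → S → A)
    (a b : S) : A :=
  open Classical in
  if ∃ j ≤ m, b = s j then c b else if ∃ i < m, a = s i then 0 else f (zip m t u a) (zip m t u b)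

section Unzip

variable {A : Type*} {c : S → A} {f : S → S → A} {a b : S}

theorem unzip_of_mem [Zero A] (hb : ∃ j ≤ m, b = s j) : unzip m s t u c f a b = c b := if_pos hb

theorem unzip_of_mem_of_notMem [Zero A] (ha : ∃ j < m, a = s j) (hb : ¬ ∃ j ≤ m, b = s j) :
    unzip m s t u c f a b = 0 :=
  (if_neg hb).trans (if_pos ha)

theorem unzip_of_notMem [Zero A] (ha : ¬ ∃ j < m, a = s j) (hb : ¬ ∃ j ≤ m, b = s j) :
    unzip m s t u c f a b = f (zip m t u a) (zip m t u b) :=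
  (if_neg hb).trans (if_neg ha)

end Unzip

namespace IsGoodDiagonal

theorem zip_t (D : IsGoodDiagonal E N m s t u) {i : ℕ} (hi : i < m) : zip m t u (t i) = u i :=
  Function.Injective.extend_apply
    (fun i j hij => Fin.ext (D.t_injOn i.2 j.2 hij)) _ _ (⟨i, hi⟩ : Fin m)

theorem zip_u (D : IsGoodDiagonal E N m s t u) {i : ℕ} (hi : i < m) : zip m t u (u i) = u i :=
  zip_of_ne fun _ hj => (D.t_ne_u hj hi).symm

theorem eq_or_of_zip_eq (D : IsGoodDiagonal E N m s t u) {x y : S}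
    (h : zip m t u x = zip m t u y) :
    x = y ∨ ∃ i < m, x = t i ∧ y = u i ∨ x = u i ∧ y = t i := by
  by_cases hx : ∃ i < m, x = t i <;> by_cases hy : ∃ i < m, y = t i
  · obtain ⟨i, hi, rfl⟩ := hx
    obtain ⟨j, hj, rfl⟩ := hy
    rw [D.zip_t hi, D.zip_t hj] at h
    exact .inl (congrArg t (D.u_injOn hi hj h))
  · obtain ⟨i, hi, rfl⟩ := hx
    rw [D.zip_t hi, zip_of_ne (by simpa using hy)] at h
    exact .inr ⟨i, hi, .inl ⟨rfl, h.symm⟩⟩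
  · obtain ⟨j, hj, rfl⟩ := hy
    rw [D.zip_t hj, zip_of_ne (by simpa using hx)] at h
    exact .inr ⟨j, hj, .inr ⟨h, rfl⟩⟩
  · rw [zip_of_ne (by simpa using hx), zip_of_ne (by simpa using hy)] at h
    exact .inl h

theorem biUnique_map_zip (D : IsGoodDiagonal E N m s t u) (hr : Relator.BiUnique r)
    (hl : ∀ i < m, (∀ x, ¬ r x (t i)) ∨ ∀ x, ¬ r x (u i))
    (hr' : ∀ i < m, (∀ x, ¬ r (t i) x) ∨ ∀ x, ¬ r (u i) x) :
    Relator.BiUnique (Relation.Map r (zip m t u) (zip m t u)) := by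
  refine ⟨?_, ?_⟩
  · rintro _ _ _ ⟨a, b, hab, rfl, rfl⟩ ⟨a', b', hab', rfl, hb⟩
    rcases D.eq_or_of_zip_eq hb with rfl | ⟨i, hi, ⟨rfl, rfl⟩ | ⟨rfl, rfl⟩⟩
    · rw [hr.1 hab hab']
    · exact ((hl i hi).elim (· _ hab') (· _ hab)).elim
    · exact ((hl i hi).elim (· _ hab) (· _ hab')).elim
  · rintro _ _ _ ⟨a, b, hab, rfl, rfl⟩ ⟨a', b', hab', ha, rfl⟩
    rcases D.eq_or_of_zip_eq ha with rfl | ⟨i, hi, ⟨rfl, rfl⟩ | ⟨rfl, rfl⟩⟩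
    · rw [hr.2 hab hab']
    · exact ((hr' i hi).elim (· _ hab') (· _ hab)).elim
    · exact ((hr' i hi).elim (· _ hab) (· _ hab')).elim

theorem not_cut_east_t (D : IsGoodDiagonal E N m s t u) {i : ℕ} (hi : i < m) (x : S) :
    ¬ Cut m s E (t i) x :=
  fun h => h.2.2 (i + 1) hi (D.east.2 h.1 (D.block i hi).2.2.2)

theorem not_cut_east_u (D : IsGoodDiagonal E N m s t u) {i : ℕ} (hi : i < m) (x : S) :
    ¬ Cut m s E x (u i) :=
  fun h => h.2.1 i hi (D.east.1 h.1 (D.block i hi).1)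

theorem not_cut_north_t (D : IsGoodDiagonal E N m s t u) {i : ℕ} (hi : i < m) (x : S) :
    ¬ Cut m s N x (t i) :=
  fun h => h.2.1 i hi (D.north.1 h.1 (D.block i hi).2.2.1)

theorem not_cut_north_u (D : IsGoodDiagonal E N m s t u) {i : ℕ} (hi : i < m) (x : S) :
    ¬ Cut m s N (u i) x :=
  fun h => h.2.2 (i + 1) hi (D.north.2 h.1 (D.block i hi).2.1)

section Unzip

variable {A : Type*} [AddCommGroup A] {f g : S → S → A}

/-- The block to the north-west of the square `s j` and the one to its south-east are zipped
together to a block. -/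
theorem add_eq_add_of_blocks (D : IsGoodDiagonal E N m s t u)
    (H : ∀ p q x y, IsBlock (Zipped m s t u E) (Zipped m s t u N) p q x y →
      f p q + g q x = g p y + f y x) {j : ℕ} (hj : j < m) {p x y p' q' x' : S}
    (hb : IsBlock E N p (s j) x y) (hb' : IsBlock E N p' q' x' (s j)) :
    g (zip m t u p) (zip m t u y) + f (zip m t u y) (zip m t u x) =
      f (zip m t u p') (zip m t u q') + g (zip m t u q') (zip m t u x') := by
  obtain rfl : x = t j := D.north.2 hb.2.1 (D.block j hj).2.2.1
  obtain rfl : x' = u j := D.east.2 hb'.2.2.2 (D.block j hj).1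
  obtain ⟨i, hi, rfl, rfl⟩ := D.exists_eq_t_of_east hj.le hb.1
  obtain ⟨_, _, hi', rfl⟩ := D.exists_eq_u_of_north hj.le hb'.2.2.1
  obtain rfl := Nat.succ_injective hi'
  have hy : ∀ k ≤ m, y ≠ s k := by
    rintro k hk rfl
    obtain ⟨l, hl, -, h⟩ := D.exists_eq_u_of_north hk hb.2.2.1
    exact D.t_ne_u hi hl h
  have hq : ∀ k ≤ m, q' ≠ s k := by
    rintro k hk rfl
    obtain ⟨l, hl, -, h⟩ := D.exists_eq_t_of_east hk hb'.1
    exact D.t_ne_u hl hi h.symm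
  have huq : Cut m s E (u i) q' := ⟨hb'.1, fun k hk => D.u_ne_s hi hk.le, hq⟩
  have hqu : Cut m s N q' (u (i + 1)) := ⟨hb'.2.1, fun k hk => hq k hk.le, fun k => D.u_ne_s hj⟩
  have hty : Cut m s N (t i) y := ⟨hb.2.2.1, fun k hk => D.t_ne_s hi hk.le, hy⟩
  have hyt : Cut m s E y (t (i + 1)) := ⟨hb.2.2.2, fun k hk => hy k hk.le, fun k => D.t_ne_s hj⟩
  have hty' := hty.zipped (t := t) (u := u)
  have hyt' := hyt.zipped (t := t) (u := u)
  rw [(D.zip_t hi).trans (D.zip_u hi).symm] at hty' ⊢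
  rw [(D.zip_t hj).trans (D.zip_u hj).symm] at hyt' ⊢
  exact (H _ _ _ _ ⟨huq.zipped, hqu.zipped, hty', hyt'⟩).symm

open Classical in
theorem exists_value (D : IsGoodDiagonal E N m s t u)
    (H : ∀ p q x y, IsBlock (Zipped m s t u E) (Zipped m s t u N) p q x y →
      f p q + g q x = g p y + f y x) (z : S) :
    ∃ c : A, (∀ p x y, IsBlock E N p z x y → (∃ j < m, z = s j) →
        g (zip m t u p) (zip m t u y) + f (zip m t u y) (zip m t u x) = c) ∧
      ∀ p q x, IsBlock E N p q x z → f (zip m t u p) (zip m t u q) +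
        g (zip m t u q) (zip m t u x) =
          c + if ∃ j < m, z = s j then 0 else f (zip m t u z) (zip m t u x) := by
  obtain ⟨c, hc, hc'⟩ := exists_const_of_forall_eq₂
    (p := fun v : S × S × S => IsBlock E N v.1 z v.2.1 v.2.2 ∧ ∃ j < m, z = s j)
    (F := fun v => g (zip m t u v.1) (zip m t u v.2.2) + f (zip m t u v.2.2) (zip m t u v.2.1))
    (q := fun v : S × S × S => IsBlock E N v.1 v.2.1 v.2.2 z)
    (F' := fun v => f (zip m t u v.1) (zip m t u v.2.1) + g (zip m t u v.2.1) (zip m t u v.2.2) -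
      if ∃ j < m, z = s j then 0 else f (zip m t u z) (zip m t u v.2.2))
    (fun v v' h h' => by
      obtain ⟨h₁, h₂, h₃⟩ := D.block_unique_of_southEast h.1 h'.1
      simp only [h₁, h₂, h₃])
    (fun v v' h h' => by
      obtain ⟨h₁, h₂, h₃⟩ := D.block_unique_of_northWest h h'
      simp only [h₁, h₂, h₃])
    (fun v v' h h' => by
      obtain ⟨j, hj, rfl⟩ := h.2
      rw [if_pos ⟨j, hj, rfl⟩, sub_zero]
      exact D.add_eq_add_of_blocks H hj h.1 h')
  exact ⟨c, fun p x y hb hz => hc (p, x, y) ⟨hb, hz⟩,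
    fun p q x hb => sub_eq_iff_eq_add.mp (hc' (p, q, x) hb)⟩

theorem exists_lt_eq_of_north (D : IsGoodDiagonal E N m s t u) {a b : S} (h : N a b)
    (ha : ∃ j ≤ m, a = s j) : ∃ j < m, a = s j :=
  let ⟨j, hj, haj⟩ := ha
  ⟨j, hj.lt_of_ne fun hm => D.not_north b (hm ▸ haj ▸ h), haj⟩

theorem unzip_closed (D : IsGoodDiagonal E N m s t u)
    (H : ∀ p q x y, IsBlock (Zipped m s t u E) (Zipped m s t u N) p q x y →
      f p q + g q x = g p y + f y x) : ∃ c, ∀ p q x y, IsBlock E N p q x y →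
      unzip m s t u c f p q + unzip m s t u c g q x =
        unzip m s t u c g p y + unzip m s t u c f y x := by
  choose c hc hc' using D.exists_value H
  refine ⟨c, fun p q x y hb => ?_⟩
  have not_lt : ∀ {z}, (¬ ∃ j ≤ m, z = s j) → ¬ ∃ j < m, z = s j :=
    fun h ⟨j, hj, hz⟩ => h ⟨j, hj.le, hz⟩
  by_cases hp : ∃ j ≤ m, p = s j
  · obtain ⟨i, hi, rfl⟩ := D.exists_lt_eq_of_north hb.2.2.1 hp
    obtain ⟨rfl, rfl, rfl⟩ := D.block_unique_of_southWest hb (D.block i hi)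
    have hu : ¬ ∃ j ≤ m, u i = s j := fun ⟨j, hj, h⟩ => D.u_ne_s hi hj h
    have ht : ¬ ∃ j ≤ m, t i = s j := fun ⟨j, hj, h⟩ => D.t_ne_s hi hj h
    rw [unzip_of_mem_of_notMem ⟨i, hi, rfl⟩ hu, unzip_of_mem_of_notMem ⟨i, hi, rfl⟩ ht,
      unzip_of_mem ⟨i + 1, hi, rfl⟩, unzip_of_mem ⟨i + 1, hi, rfl⟩]
  have hx : ¬ ∃ j ≤ m, x = s j := fun ⟨j, hj, hx⟩ => by
    obtain ⟨i, hi, -, rfl⟩ := D.exists_eq_u_of_north hj (hx ▸ hb.2.1)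
    exact hp ⟨i, hi.le, D.east.1 hb.1 (D.block i hi).1⟩
  by_cases hq : ∃ j ≤ m, q = s j
  · have hy : ¬ ∃ j ≤ m, y = s j := fun ⟨j, hj, hy⟩ => by
      obtain ⟨k, hk, hq⟩ := hq
      obtain ⟨i, hi, -, rfl⟩ := D.exists_eq_u_of_north hj (hy ▸ hb.2.2.1)
      obtain ⟨l, hl, -, h⟩ := D.exists_eq_t_of_east hk (hq ▸ hb.1)
      exact D.t_ne_u hl hi h.symm
    have hq' := D.exists_lt_eq_of_north hb.2.1 hq
    rw [unzip_of_mem hq, unzip_of_mem_of_notMem hq' hx, unzip_of_notMem (not_lt hp) hy,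
      unzip_of_notMem (not_lt hy) hx, add_zero, hc q p x y hb hq']
  by_cases hy : ∃ j ≤ m, y = s j
  · rw [unzip_of_notMem (not_lt hp) hq, unzip_of_notMem (not_lt hq) hx, unzip_of_mem hy,
      hc' y p q x hb, unzip, if_neg hx]
  · rw [unzip_of_notMem (not_lt hp) hq, unzip_of_notMem (not_lt hq) hx,
      unzip_of_notMem (not_lt hp) hy, unzip_of_notMem (not_lt hy) hx]
    exact H _ _ _ _ ⟨(Cut.of_notMem hb.1 hp hq).zipped, (Cut.of_notMem hb.2.1 hq hx).zipped,
      (Cut.of_notMem hb.2.2.1 hp hy).zipped, (Cut.of_notMem hb.2.2.2 hy hx).zipped⟩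

end Unzip

theorem isExactGrid_zipped (D : IsGoodDiagonal E N m s t u) :
    IsExactGrid (Zipped m s t u E) (Zipped m s t u N) where
  east := D.biUnique_map_zip (cut_biUnique D.east) (fun _ hi => .inr (D.not_cut_east_u hi))
    fun _ hi => .inl (D.not_cut_east_t hi)
  north := D.biUnique_map_zip (cut_biUnique D.north) (fun _ hi => .inl (D.not_cut_north_t hi))
    fun _ hi => .inr (D.not_cut_north_u hi)
  exact A _ f g H := by
    obtain ⟨c, hc⟩ := D.unzip_closed H
    obtain ⟨h, hE, hN⟩ := D.exact A _ _ hc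
    have hzip : ∀ x, h (zip m t u x) = h x := fun x => by
      by_cases hx : ∃ i < m, x = t i
      · obtain ⟨i, hi, rfl⟩ := hx
        have hu := hE _ _ (D.block i hi).1
        have ht := hN _ _ (D.block i hi).2.2.1
        rw [unzip_of_mem_of_notMem ⟨i, hi, rfl⟩ fun ⟨j, hj, h⟩ => D.u_ne_s hi hj h] at hu
        rw [unzip_of_mem_of_notMem ⟨i, hi, rfl⟩ fun ⟨j, hj, h⟩ => D.t_ne_s hi hj h] at ht
        rw [D.zip_t hi]
        exact sub_left_injective (hu.symm.trans ht)
      · rw [zip_of_ne (by simpa using hx)]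
    have cut : ∀ {r : S → S → Prop} {f : S → S → A} {a b}, Cut m s r a b →
        unzip m s t u c f a b = f (zip m t u a) (zip m t u b) := fun hab =>
      unzip_of_notMem (fun ⟨j, hj, h⟩ => hab.2.1 j hj h) fun ⟨j, hj, h⟩ => hab.2.2 j hj h
    refine ⟨h, ?_, ?_⟩
    · rintro _ _ ⟨a, b, hab, rfl, rfl⟩
      rw [hzip, hzip, ← hE a b hab.1, cut hab]
    · rintro _ _ ⟨a, b, hab, rfl, rfl⟩
      rw [hzip, hzip, ← hN a b hab.1, cut hab]

end IsGoodDiagonal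

end Zip

section Staircase

variable {R C : Type*} {M : R → C → ℤ} {P : Finset R} {Q : Finset C} {m : ℕ} {t u : ℕ → R}
  {s : ℕ → C}

open Classical in
/-- The matrix `M` after the row `t i` has been subtracted from the row `u i`, for all `i < j`. -/
noncomputable def subtractRows (M : R → C → ℤ) (t u : ℕ → R) (j : ℕ) (x : R) (y : C) : ℤ :=
  M x y - ∑ i ∈ Finset.range j, if x = u i then M (t i) y else 0

theorem subtractRows_of_ne {j : ℕ} {x : R} (hx : ∀ i < j, x ≠ u i) (y : C) :
    subtractRows M t u j x y = M x y := by
  rw [subtractRows, Finset.sum_eq_zero fun i hi => if_neg (hx i (Finset.mem_range.mp hi)), sub_zero]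

theorem subtractRows_apply {i j : ℕ} (hu : Set.InjOn u (Set.Iio j)) (hi : i < j) (y : C) :
    subtractRows M t u j (u i) y = M (u i) y - M (t i) y := by
  rw [subtractRows, Finset.sum_eq_single i, if_pos rfl]
  · exact fun k hk hki => if_neg fun h => hki (hu hi (Finset.mem_range.mp hk) h).symm
  · exact fun h => absurd (Finset.mem_range.mpr hi) h

theorem subtractRows_apply_pivot [DecidableEq R] {j : ℕ} {x : R} {y : C}
    (hu : Set.InjOn u (Set.Iic j)) (htu : ∀ i < j, t j ≠ u i) (ht : M (t j) y = 1)
    (hut : ∀ i ≤ j, M (u i) y = M (t i) y)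
    (hcol : (∀ i ≤ j, x ≠ t i) → (∀ i ≤ j, x ≠ u i) → M x y = 0) (hx : ∀ i < j, x ≠ t i) :
    subtractRows M t u j x y = if x = t j ∨ x = u j then 1 else 0 := by
  by_cases hxu : ∃ i < j, x = u i
  · obtain ⟨i, hi, rfl⟩ := hxu
    rw [subtractRows_apply (hu.mono fun k hk => (Set.mem_Iio.mp hk).le) hi, hut i hi.le, sub_self,
      if_neg]
    exact not_or_intro (htu i hi).symm fun h => hi.ne (hu hi.le Set.self_mem_Iic h)
  · rw [subtractRows_of_ne (by simpa using hxu)]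
    split_ifs with hx'
    · rcases hx' with rfl | rfl
      exacts [ht, (hut j le_rfl).trans ht]
    · rw [not_or] at hx'
      refine hcol (fun i hi => ?_) fun i hi => ?_ <;> rcases hi.lt_or_eq with hi | rfl
      exacts [hx i hi, hx'.1, fun h => hxu ⟨i, hi, h⟩, hx'.2]

theorem mem_sdiff_image_range [DecidableEq R] {x : R} :
    x ∈ P \ (Finset.range m).image t ↔ x ∈ P ∧ ∀ i < m, x ≠ t i := by
  simp [eq_comm]

theorem sdiff_image_range_succ [DecidableEq R] (P : Finset R) (t : ℕ → R) (j : ℕ) :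
    P \ (Finset.range (j + 1)).image t = (P \ (Finset.range j).image t).erase (t j) := by
  rw [Finset.range_add_one, Finset.image_insert, Finset.sdiff_insert]

theorem FactorsOn.of_subtractRows [DecidableEq R] [DecidableEq C]
    (ht : Set.InjOn t (Set.Iio m)) (hu : Set.InjOn u (Set.Iio m)) (hs : Set.InjOn s (Set.Iio m))
    (htu : ∀ i < m, ∀ j < m, t i ≠ u j) (htP : ∀ i < m, t i ∈ P) (hsQ : ∀ i < m, s i ∈ Q)
    (hrow : ∀ i < m, ∀ y ∈ Q, M (t i) y = 0 ∨ M (t i) y = 1 ∨ M (t i) y = -1)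
    (hts : ∀ i < m, M (t i) (s i) = 1) (hus : ∀ i < m, ∀ j < m, M (u i) (s j) = M (t i) (s j))
    (hcol : ∀ j < m, ∀ x ∈ P, (∀ i ≤ j, x ≠ t i) → (∀ i ≤ j, x ≠ u i) → M x (s j) = 0)
    (h : FactorsOn (subtractRows M t u m) (P \ (Finset.range m).image t)
      (Q \ (Finset.range m).image s)) : FactorsOn M P Q := by
  have hzero : subtractRows M t u 0 = M := by
    ext x y
    simp [subtractRows]
  suffices ∀ j ≤ m, FactorsOn (subtractRows M t u j) (P \ (Finset.range j).image t)
      (Q \ (Finset.range j).image s) by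
    simpa [hzero] using this 0 (Nat.zero_le m)
  refine fun j hj => Nat.decreasingInduction (fun j hj ih => ?_) h hj
  have htu' : ∀ i < j, t j ≠ u i := fun i hi => htu j hj i (hi.trans hj)
  have hpivot_col : ∀ x ∈ P, (∀ i < j, x ≠ t i) →
      subtractRows M t u j x (s j) = if x = t j ∨ x = u j then 1 else 0 := fun x hx hxt =>
    subtractRows_apply_pivot (hu.mono (Set.Iic_subset_Iio.mpr hj)) htu' (hts j hj)
      (fun i hi => hus i (hi.trans_lt hj) j hj) (hcol j hj x hx) hxt
  have htj : t j ∈ P \ (Finset.range j).image t := mem_sdiff_image_range.mpr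
    ⟨htP j hj, fun i hi h => hi.ne' (ht hj (hi.trans hj) h)⟩
  have hsj : s j ∈ Q \ (Finset.range j).image s := mem_sdiff_image_range.mpr
    ⟨hsQ j hj, fun i hi h => hi.ne' (hs hj (hi.trans hj) h)⟩
  refine FactorsOn.pivot htj hsj ?_ (fun x hx => ?_) (fun y hy => ?_) ?_
  · rw [hpivot_col _ (htP j hj) (mem_sdiff_image_range.mp htj).2, if_pos (.inl rfl)]
  · rw [hpivot_col x (mem_sdiff_image_range.mp hx).1 (mem_sdiff_image_range.mp hx).2]
    split_ifs <;> simp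
  · rw [subtractRows_of_ne htu']
    exact hrow j hj y (mem_sdiff_image_range.mp hy).1
  · rw [← sdiff_image_range_succ, ← sdiff_image_range_succ]
    refine ih.congr fun x hx y _ => ?_
    obtain ⟨hxP, hxt⟩ := mem_sdiff_image_range.mp hx
    rw [hpivot_col x hxP fun i hi => hxt i (by omega), subtractRows_of_ne htu', subtractRows,
      subtractRows, Finset.sum_range_succ]
    simp only [hxt j j.lt_succ_self, false_or]
    split_ifs <;> ring

end Staircase

section Reduction

variable {S : Type*} {E N E' N' : S → S → Prop} {P Q : Finset S} {m : ℕ} {s t u : ℕ → S}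

/-- The graph of neighbors in a grid, without directions. -/
def gridGraph (E N : S → S → Prop) : SimpleGraph S := SimpleGraph.fromRel (E ⊔ N)

theorem gridGraph_adj {a b : S} :
    (gridGraph E N).Adj a b ↔ a ≠ b ∧ ((E a b ∨ N a b) ∨ E b a ∨ N b a) :=
  Iff.rfl

theorem gridGraph_swap (E N : S → S → Prop) : gridGraph N E = gridGraph E N :=
  congrArg SimpleGraph.fromRel (sup_comm N E)

theorem gridGraph_flip (E N : S → S → Prop) : gridGraph (flip E) (flip N) = gridGraph E N := by
  ext a b
  exact and_congr_right fun _ => or_comm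

open Classical in
/-- The adjacency matrix of the graph of neighbors. -/
noncomputable def gridMatrix (E N : S → S → Prop) (a b : S) : ℤ :=
  (gridGraph E N).adjMatrix ℤ a b

theorem gridMatrix_of_adj {a b : S} (h : (gridGraph E N).Adj a b) : gridMatrix E N a b = 1 :=
  if_pos h

theorem gridMatrix_of_not_adj {a b : S} (h : ¬ (gridGraph E N).Adj a b) : gridMatrix E N a b = 0 :=
  if_neg h

theorem gridMatrix_congr {a b c d : S}
    (h : (gridGraph E N).Adj a b ↔ (gridGraph E' N').Adj c d) :
    gridMatrix E N a b = gridMatrix E' N' c d := by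
  by_cases hcd : (gridGraph E' N').Adj c d
  · rw [gridMatrix_of_adj hcd, gridMatrix_of_adj (h.mpr hcd)]
  · rw [gridMatrix_of_not_adj hcd, gridMatrix_of_not_adj (hcd ∘ h.mp)]

theorem gridMatrix_comm (a b : S) : gridMatrix E N a b = gridMatrix E N b a :=
  gridMatrix_congr (SimpleGraph.adj_comm ..)

theorem gridMatrix_eq_zero_or (a b : S) :
    gridMatrix E N a b = 0 ∨ gridMatrix E N a b = 1 ∨ gridMatrix E N a b = -1 := by
  by_cases h : (gridGraph E N).Adj a b
  exacts [.inr (.inl (gridMatrix_of_adj h)), .inl (gridMatrix_of_not_adj h)]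

theorem isBipartiteWith_erase [DecidableEq S] {c d : S} (B : (gridGraph E N).IsBipartiteWith P Q)
    (hc : ∀ a b, (gridGraph E' N').Adj a b → (gridGraph E N).Adj a b ∧ a ≠ c ∧ a ≠ d) :
    (gridGraph E' N').IsBipartiteWith (P.erase c : Finset S) (Q.erase d : Finset S) where
  disjoint := B.disjoint.mono (by simp) (by simp)
  mem_of_adj a b hab := by
    obtain ⟨hE, hac, had⟩ := hc a b hab
    obtain ⟨-, hbc, hbd⟩ := hc b a hab.symm
    simpa [hac, had, hbc, hbd] using B.mem_of_adj hE

/-- The matrix of a bipartite grid factors as soon as that of some exact grid with fewer squares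
does. -/
def HasReduction (E N : S → S → Prop) (P Q : Finset S) : Prop :=
  ∃ E' N' : S → S → Prop, ∃ P' Q' : Finset S,
    IsExactGrid E' N' ∧ (gridGraph E' N').IsBipartiteWith P' Q' ∧
      P'.card + Q'.card < P.card + Q.card ∧
        (FactorsOn (gridMatrix E' N') P' Q' → FactorsOn (gridMatrix E N) P Q)

namespace IsGoodDiagonal

theorem s_mem (D : IsGoodDiagonal E N m s t u) (B : (gridGraph E N).IsBipartiteWith P Q)
    (hs : s 0 ∈ Q) {i : ℕ} (hi : i ≤ m) : s i ∈ Q := by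
  induction i with
  | zero => exact hs
  | succ i ih =>
    have hsu : (gridGraph E N).Adj (s i) (u i) := ⟨(D.u_ne_s hi (by omega)).symm,
      .inl (.inl (D.block i hi).1)⟩
    have hus : (gridGraph E N).Adj (u i) (s (i + 1)) := ⟨D.u_ne_s hi hi,
      .inl (.inr (D.block i hi).2.1)⟩
    exact B.mem_of_mem_adj (B.mem_of_mem_adj' (ih (by omega)) hsu.symm) hus

theorem adj_t_s (D : IsGoodDiagonal E N m s t u) {i j : ℕ} (hi : i < m) (hj : j ≤ m) :
    (gridGraph E N).Adj (t i) (s j) ↔ j = i ∨ j = i + 1 := by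
  constructor
  · obtain ⟨X, Y, hE, hN, hs, ht, -⟩ := D.exists_position
    have hsj := hs j hj
    have hti := ht i hi
    rintro ⟨-, (h | h) | h | h⟩
    · have := hE _ _ h; omega
    · have := hN _ _ h; omega
    · have := hE _ _ h; omega
    · have := hN _ _ h; omega
  · refine fun h => ⟨D.t_ne_s hi hj, ?_⟩
    rcases h with rfl | rfl
    exacts [.inr (.inr (D.block j hi).2.2.1), .inl (.inl (D.block i hi).2.2.2)]

theorem adj_u_s (D : IsGoodDiagonal E N m s t u) {i j : ℕ} (hi : i < m) (hj : j ≤ m) :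
    (gridGraph E N).Adj (u i) (s j) ↔ j = i ∨ j = i + 1 := by
  constructor
  · obtain ⟨X, Y, hE, hN, hs, -, hu⟩ := D.exists_position
    have hsj := hs j hj
    have hui := hu i hi
    rintro ⟨-, (h | h) | h | h⟩
    · have := hE _ _ h; omega
    · have := hN _ _ h; omega
    · have := hE _ _ h; omega
    · have := hN _ _ h; omega
  · refine fun h => ⟨D.u_ne_s hi hj, ?_⟩
    rcases h with rfl | rfl
    exacts [.inr (.inl (D.block j hi).1), .inl (.inr (D.block i hi).2.1)]

theorem t_mem (D : IsGoodDiagonal E N m s t u) (B : (gridGraph E N).IsBipartiteWith P Q)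
    (hs : s 0 ∈ Q) {i : ℕ} (hi : i < m) : t i ∈ P :=
  B.mem_of_mem_adj' (D.s_mem B hs hi.le) ((D.adj_t_s hi hi.le).mpr (.inl rfl))

theorem u_mem (D : IsGoodDiagonal E N m s t u) (B : (gridGraph E N).IsBipartiteWith P Q)
    (hs : s 0 ∈ Q) {i : ℕ} (hi : i < m) : u i ∈ P :=
  B.mem_of_mem_adj' (D.s_mem B hs hi.le) ((D.adj_u_s hi hi.le).mpr (.inl rfl))

theorem eq_of_adj_s (D : IsGoodDiagonal E N m s t u) {j : ℕ} (hj : j < m) {x : S}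
    (h : (gridGraph E N).Adj x (s j)) : ∃ i ≤ j, x = t i ∨ x = u i := by
  rcases h with ⟨-, (h | h) | h | h⟩
  · obtain ⟨i, -, rfl, rfl⟩ := D.exists_eq_t_of_east hj.le h
    exact ⟨i, i.le_succ, .inl rfl⟩
  · obtain ⟨i, -, rfl, rfl⟩ := D.exists_eq_u_of_north hj.le h
    exact ⟨i, i.le_succ, .inr rfl⟩
  · exact ⟨j, le_rfl, .inr (D.east.2 h (D.block j hj).1)⟩
  · exact ⟨j, le_rfl, .inl (D.north.2 h (D.block j hj).2.2.1)⟩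

theorem factorsOn_of_subtractRows [DecidableEq S] (D : IsGoodDiagonal E N m s t u)
    (B : (gridGraph E N).IsBipartiteWith P Q) (hs : s 0 ∈ Q)
    (h : FactorsOn (subtractRows (gridMatrix E N) t u m) (P \ (Finset.range m).image t)
      (Q \ (Finset.range m).image s)) : FactorsOn (gridMatrix E N) P Q :=
  FactorsOn.of_subtractRows D.t_injOn D.u_injOn (D.s_injOn.mono Set.Iio_subset_Iic_self)
    (fun _ hi _ hj => D.t_ne_u hi hj) (fun _ hi => D.t_mem B hs hi)
    (fun _ hi => D.s_mem B hs (le_of_lt hi)) (fun _ _ _ _ => gridMatrix_eq_zero_or _ _)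
    (fun _ hi => gridMatrix_of_adj ((D.adj_t_s hi (le_of_lt hi)).mpr (.inl rfl)))
    (fun _ hi _ hj => gridMatrix_congr
      ((D.adj_u_s hi (le_of_lt hj)).trans (D.adj_t_s hi (le_of_lt hj)).symm))
    (fun _ hj _ _ ht hu => gridMatrix_of_not_adj fun hadj =>
      let ⟨i, hi, hx⟩ := D.eq_of_adj_s hj hadj
      hx.elim (ht i hi) (hu i hi)) h

open Classical in
theorem exists_height (D : IsGoodDiagonal E N m s t u) : ∃ h : S → ℤ,
    (∀ a b, E a b → h b = h a - if ∃ j ≤ m, b = s j then 1 else 0) ∧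
    ∀ a b, N a b → h b = h a + if ∃ j ≤ m, a = s j then 1 else 0 := by
  obtain ⟨h, hE, hN⟩ := D.exact ℤ (fun _ b => - if ∃ j ≤ m, b = s j then 1 else 0)
    (fun a _ => if ∃ j ≤ m, a = s j then 1 else 0) fun p q x y hb => by
      have hpx : (∃ j ≤ m, x = s j) ↔ ∃ j ≤ m, p = s j := by
        constructor
        · rintro ⟨j, hj, rfl⟩
          obtain ⟨i, hi, rfl, rfl⟩ := D.exists_eq_u_of_north hj hb.2.1
          exact ⟨i, hi.le, D.east.1 hb.1 (D.block i hi).1⟩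
        · intro hp
          obtain ⟨i, hi, rfl⟩ := D.exists_lt_eq_of_north hb.2.2.1 hp
          exact ⟨i + 1, hi, (D.block_unique_of_southWest hb (D.block i hi)).2.1⟩
      simp only [hpx]
      ring
  exact ⟨h, fun a b hab => by linarith [hE a b hab], fun a b hab => by linarith [hN a b hab]⟩

theorem exists_sign (D : IsGoodDiagonal E N m s t u) : ∃ ε : S → ℤ, (∀ x, ε x = 1 ∨ ε x = -1) ∧
    (∀ a b, (gridGraph (Cut m s E) (Cut m s N)).Adj a b → ε a = ε b) ∧
      ∀ i < m, ε (t i) = -ε (u i) := by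
  obtain ⟨h, hE, hN⟩ := D.exists_height
  have cut_east : ∀ a b, Cut m s E a b → h a = h b := fun a b hab => by
    rw [hE a b hab.1, if_neg fun ⟨j, hj, hb⟩ => hab.2.2 j hj hb, sub_zero]
  have cut_north : ∀ a b, Cut m s N a b → h a = h b := fun a b hab => by
    rw [hN a b hab.1, if_neg fun ha => ?_, add_zero]
    obtain ⟨j, hj, ha⟩ := D.exists_lt_eq_of_north hab.1 ha
    exact hab.2.1 j hj ha
  have jump : ∀ i < m, h (t i) = h (u i) + 1 := fun i hi => by
    rw [hN _ _ (D.block i hi).2.2.1, hE _ _ (D.block i hi).1, if_pos ⟨i, hi.le, rfl⟩,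
      if_neg fun ⟨j, hj, hu⟩ => D.u_ne_s hi hj hu, sub_zero]
  refine ⟨fun x => ((h x).negOnePow : ℤˣ), fun x => ?_, ?_, fun i hi => ?_⟩
  · exact (Int.units_eq_one_or (h x).negOnePow).imp (fun hx => by simp only [hx, Units.val_one])
      (fun hx => by simp only [hx, Units.val_neg, Units.val_one])
  · rintro a b ⟨-, (hab | hab) | hab | hab⟩
    exacts [by simp only [cut_east a b hab], by simp only [cut_north a b hab],
      by simp only [cut_east b a hab], by simp only [cut_north b a hab]]
  · simp only [jump i hi, Int.negOnePow_succ, Units.val_neg]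

theorem zip_of_mem (D : IsGoodDiagonal E N m s t u) (B : (gridGraph E N).IsBipartiteWith P Q)
    (hs : s 0 ∈ Q) {y : S} (hy : y ∈ Q) : zip m t u y = y :=
  zip_of_ne fun _ hi h => Set.disjoint_left.mp B.disjoint (D.t_mem B hs hi) (h ▸ hy)

theorem zip_eq_iff (D : IsGoodDiagonal E N m s t u) {x y : S} (hx : ∀ i < m, x ≠ t i) :
    zip m t u y = x ↔ y = x ∨ ∃ i < m, x = u i ∧ y = t i := by
  constructor
  · intro h
    rw [← zip_of_ne (u := u) hx] at h
    rcases D.eq_or_of_zip_eq h with h | ⟨i, hi, ⟨hy, hx⟩ | ⟨-, hx'⟩⟩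
    exacts [.inl h, .inr ⟨i, hi, hx, hy⟩, absurd hx' (hx i hi)]
  · rintro (rfl | ⟨i, hi, rfl, rfl⟩)
    exacts [zip_of_ne hx, D.zip_t hi]

theorem exists_of_zipped_adj {x y : S}
    (h : (gridGraph (Zipped m s t u E) (Zipped m s t u N)).Adj x y) :
    ∃ a b, (gridGraph (Cut m s E) (Cut m s N)).Adj a b ∧ zip m t u a = x ∧ zip m t u b = y := by
  obtain ⟨hxy, (⟨a, b, hab, rfl, rfl⟩ | ⟨a, b, hab, rfl, rfl⟩) |
    ⟨a, b, hab, rfl, rfl⟩ | ⟨a, b, hab, rfl, rfl⟩⟩ := h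
  exacts [⟨a, b, ⟨ne_of_apply_ne _ hxy, .inl (.inl hab)⟩, rfl, rfl⟩,
    ⟨a, b, ⟨ne_of_apply_ne _ hxy, .inl (.inr hab)⟩, rfl, rfl⟩,
    ⟨b, a, ⟨ne_of_apply_ne _ hxy, .inr (.inl hab)⟩, rfl, rfl⟩,
    ⟨b, a, ⟨ne_of_apply_ne _ hxy, .inr (.inr hab)⟩, rfl, rfl⟩]

theorem zipped_adj {a b : S} (h : (gridGraph (Cut m s E) (Cut m s N)).Adj a b)
    (hab : zip m t u a ≠ zip m t u b) :
    (gridGraph (Zipped m s t u E) (Zipped m s t u N)).Adj (zip m t u a) (zip m t u b) :=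
  ⟨hab, h.2.imp (Or.imp Cut.zipped Cut.zipped) (Or.imp Cut.zipped Cut.zipped)⟩

theorem adj_of_cut {a b : S} (h : (gridGraph (Cut m s E) (Cut m s N)).Adj a b) :
    (gridGraph E N).Adj a b ∧ ∀ i < m, a ≠ s i :=
  ⟨⟨h.1, h.2.imp (Or.imp And.left And.left) (Or.imp And.left And.left)⟩, fun i hi => by
    rcases h.2 with (h | h) | h | h
    exacts [h.2.1 i hi, h.2.1 i hi, h.2.2 i hi.le, h.2.2 i hi.le]⟩

theorem cut_adj_iff (D : IsGoodDiagonal E N m s t u) {x y : S} (hxs : ∀ i ≤ m, x ≠ s i)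
    (hys : ∀ i < m, y ≠ s i) (h : y = s m → ∀ i < m, x ≠ t i ∧ x ≠ u i) :
    (gridGraph (Cut m s E) (Cut m s N)).Adj x y ↔ (gridGraph E N).Adj x y := by
  refine ⟨fun hadj => (adj_of_cut hadj).1, fun ⟨hne, hadj⟩ => ⟨hne, ?_⟩⟩
  have hys' : (E x y ∨ N x y) → ∀ i ≤ m, y ≠ s i := by
    rintro hxy i hi rfl
    obtain rfl := hi.eq_of_not_lt fun hi => hys i hi rfl
    rcases hxy with hxy | hxy
    · obtain ⟨j, hj, -, hx⟩ := D.exists_eq_t_of_east le_rfl hxy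
      exact (h rfl j hj).1 hx
    · obtain ⟨j, hj, -, hx⟩ := D.exists_eq_u_of_north le_rfl hxy
      exact (h rfl j hj).2 hx
  have hxs' : ∀ i < m, x ≠ s i := fun i hi => hxs i hi.le
  rcases hadj with hxy | hyx
  · exact .inl (hxy.imp (⟨·, hxs', hys' hxy⟩) (⟨·, hxs', hys' hxy⟩))
  · exact .inr (hyx.imp (⟨·, hys, hxs⟩) (⟨·, hys, hxs⟩))

theorem not_cut_adj_t (D : IsGoodDiagonal E N m s t u) {i : ℕ} (hi : i < m) :
    ¬ (gridGraph (Cut m s E) (Cut m s N)).Adj (t i) (s m) := by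
  obtain ⟨X, Y, hE, -, hs, ht, -⟩ := D.exists_position
  rintro ⟨-, (h | h) | h | h⟩
  · exact h.2.2 m le_rfl rfl
  · exact h.2.2 m le_rfl rfl
  · have := hE _ _ h.1
    have := hs m le_rfl
    have := ht i hi
    omega
  · exact D.not_north _ h.1

theorem not_cut_adj_u (D : IsGoodDiagonal E N m s t u) {i : ℕ} (hi : i < m) :
    ¬ (gridGraph (Cut m s E) (Cut m s N)).Adj (u i) (s m) := by
  rintro ⟨-, (h | h) | h | h⟩
  exacts [h.2.2 m le_rfl rfl, h.2.2 m le_rfl rfl, D.not_cut_east_u hi _ h, D.not_north _ h.1]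

theorem gridMatrix_sub_eq_cut (D : IsGoodDiagonal E N m s t u) {i : ℕ} (hi : i < m) {y : S}
    (hys : ∀ i < m, y ≠ s i) :
    gridMatrix E N (u i) y - gridMatrix E N (t i) y =
      gridMatrix (Cut m s E) (Cut m s N) (u i) y - gridMatrix (Cut m s E) (Cut m s N) (t i) y := by
  by_cases hy : y = s m
  · subst hy
    rw [gridMatrix_congr ((D.adj_u_s hi le_rfl).trans (D.adj_t_s hi le_rfl).symm), sub_self,
      gridMatrix_of_not_adj (D.not_cut_adj_u hi), gridMatrix_of_not_adj (D.not_cut_adj_t hi),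
      sub_self]
  · rw [gridMatrix_congr (D.cut_adj_iff (fun _ => D.u_ne_s hi) hys (absurd · hy)),
      gridMatrix_congr (D.cut_adj_iff (fun _ => D.t_ne_s hi) hys (absurd · hy))]

theorem zipped_adj_iff (D : IsGoodDiagonal E N m s t u)
    (B : (gridGraph E N).IsBipartiteWith P Q) (hs : s 0 ∈ Q) {x y : S} (hx : x ∈ P)
    (hxt : ∀ i < m, x ≠ t i) (hy : y ∈ Q) :
    (gridGraph (Zipped m s t u E) (Zipped m s t u N)).Adj x y ↔
      (gridGraph (Cut m s E) (Cut m s N)).Adj x y ∨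
        ∃ i < m, x = u i ∧ (gridGraph (Cut m s E) (Cut m s N)).Adj (t i) y := by
  have hPQ : ∀ z ∈ P, z ∉ Q := fun z hz => Set.disjoint_left.mp B.disjoint hz
  have hxy : x ≠ y := fun h => hPQ x hx (h ▸ hy)
  constructor
  · intro h
    obtain ⟨a, b, hab, ha, hb⟩ := exists_of_zipped_adj h
    have hyt : ∀ i < m, y ≠ t i := fun i hi h => hPQ _ (D.t_mem B hs hi) (h ▸ hy)
    rcases (D.zip_eq_iff hyt).mp hb with rfl | ⟨i, hi, rfl, -⟩
    · rcases (D.zip_eq_iff hxt).mp ha with rfl | ⟨i, hi, rfl, rfl⟩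
      exacts [.inl hab, .inr ⟨i, hi, rfl, hab⟩]
    · exact absurd hy (hPQ _ (D.u_mem B hs hi))
  · have hzy : zip m t u y = y := D.zip_of_mem B hs hy
    rintro (h | ⟨i, hi, rfl, h⟩)
    · have hzx := zip_of_ne (u := u) hxt
      simpa only [hzx, hzy] using zipped_adj (t := t) (u := u) h (by rwa [hzx, hzy])
    · simpa only [D.zip_t hi, hzy] using zipped_adj (t := t) (u := u) h (by rwa [D.zip_t hi, hzy])

theorem exists_sign_subtractRows_eq [DecidableEq S] (D : IsGoodDiagonal E N m s t u)
    (B : (gridGraph E N).IsBipartiteWith P Q) (hs : s 0 ∈ Q) :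
    ∃ ε : S → ℤ, (∀ x, ε x = 1 ∨ ε x = -1) ∧
      ∀ x ∈ P \ (Finset.range m).image t, ∀ y ∈ Q \ (Finset.range m).image s,
        subtractRows (gridMatrix E N) t u m x y =
          ε x * (ε y * gridMatrix (Zipped m s t u E) (Zipped m s t u N) x y) := by
  obtain ⟨ε, hε, hcut, hjump⟩ := D.exists_sign
  refine ⟨ε, hε, fun x hx y hy => ?_⟩
  rw [mem_sdiff_image_range] at hx hy
  have sq : ε y * ε y = 1 := by rcases hε y with h | h <;> simp [h]
  have zipped_iff := D.zipped_adj_iff B hs hx.1 hx.2 hy.1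
  by_cases hxu : ∃ i < m, x = u i
  · obtain ⟨i, hi, rfl⟩ := hxu
    rw [subtractRows_apply D.u_injOn hi, D.gridMatrix_sub_eq_cut hi hy.2]
    by_cases hu : (gridGraph (Cut m s E) (Cut m s N)).Adj (u i) y <;>
      by_cases ht : (gridGraph (Cut m s E) (Cut m s N)).Adj (t i) y
    · grind [hjump i hi, hcut _ _ hu, hcut _ _ ht, hε y]
    · rw [gridMatrix_of_adj hu, gridMatrix_of_not_adj ht,
        gridMatrix_of_adj (zipped_iff.mpr (.inl hu)), hcut _ _ hu]
      linarith
    · rw [gridMatrix_of_not_adj hu, gridMatrix_of_adj ht,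
        gridMatrix_of_adj (zipped_iff.mpr (.inr ⟨i, hi, rfl, ht⟩)), ← neg_eq_iff_eq_neg.mpr
        (hjump i hi), hcut _ _ ht]
      linarith
    · have hz : ¬ (gridGraph (Zipped m s t u E) (Zipped m s t u N)).Adj (u i) y := fun h => by
        obtain h | ⟨j, hj, huj, h⟩ := zipped_iff.mp h
        exacts [hu h, ht (D.u_injOn hi hj huj ▸ h)]
      simp only [gridMatrix_of_not_adj, hu, ht, hz, not_false_eq_true, sub_self, mul_zero]
  · push Not at hxu
    have hxs : ∀ i ≤ m, x ≠ s i := fun i hi h =>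
      Set.disjoint_left.mp B.disjoint hx.1 (h ▸ D.s_mem B hs hi)
    have adj_iff := D.cut_adj_iff hxs hy.2 fun _ i hi => ⟨hx.2 i hi, hxu i hi⟩
    rw [subtractRows_of_ne hxu]
    by_cases h : (gridGraph E N).Adj x y
    · rw [gridMatrix_of_adj h, gridMatrix_of_adj (zipped_iff.mpr (.inl (adj_iff.mpr h))),
        hcut _ _ (adj_iff.mpr h)]
      linarith
    · have hz : ¬ (gridGraph (Zipped m s t u E) (Zipped m s t u N)).Adj x y := fun hz => by
        obtain hz | ⟨i, hi, hx, -⟩ := zipped_iff.mp hz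
        exacts [h (adj_iff.mp hz), hxu i hi hx]
      simp only [gridMatrix_of_not_adj, h, hz, not_false_eq_true, mul_zero]

theorem isBipartiteWith_zipped [DecidableEq S] (D : IsGoodDiagonal E N m s t u)
    (B : (gridGraph E N).IsBipartiteWith P Q) (hs : s 0 ∈ Q) :
    (gridGraph (Zipped m s t u E) (Zipped m s t u N)).IsBipartiteWith
      (P \ (Finset.range m).image t : Finset S) (Q \ (Finset.range m).image s : Finset S) where
  disjoint := B.disjoint.mono (by simp) (by simp)
  mem_of_adj x y hxy := by
    obtain ⟨a, b, hab, rfl, rfl⟩ := exists_of_zipped_adj hxy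
    have zip_mem : ∀ x ∈ P, zip m t u x ∈ P \ (Finset.range m).image t := fun x hx => by
      rw [mem_sdiff_image_range]
      by_cases ht : ∃ i < m, x = t i
      · obtain ⟨i, hi, rfl⟩ := ht
        rw [D.zip_t hi]
        exact ⟨D.u_mem B hs hi, fun j hj h => D.t_ne_u hj hi h.symm⟩
      · push Not at ht
        rw [zip_of_ne ht]
        exact ⟨hx, ht⟩
    have zip_mem' : ∀ y ∈ Q, (∀ i < m, y ≠ s i) →
        zip m t u y ∈ Q \ (Finset.range m).image s := fun y hy hys => by
      rw [mem_sdiff_image_range, D.zip_of_mem B hs hy]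
      exact ⟨hy, hys⟩
    obtain ⟨ha, hb⟩ | ⟨ha, hb⟩ := B.mem_of_adj (adj_of_cut hab).1
    · exact .inl ⟨zip_mem a ha, zip_mem' b hb (adj_of_cut hab.symm).2⟩
    · exact .inr ⟨zip_mem' a ha (adj_of_cut hab).2, zip_mem b hb⟩

theorem hasReduction_of_lt (D : IsGoodDiagonal E N m s t u)
    (B : (gridGraph E N).IsBipartiteWith P Q) (hs : s 0 ∈ Q) (hm : 0 < m) :
    HasReduction E N P Q := by
  classical
  obtain ⟨ε, hε, heq⟩ := D.exists_sign_subtractRows_eq B hs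
  refine ⟨_, _, _, _, D.isExactGrid_zipped, D.isBipartiteWith_zipped B hs, ?_, fun h =>
    D.factorsOn_of_subtractRows B hs (((h.scale_cols hε).scale_rows hε).congr heq)⟩
  refine add_lt_add_of_le_of_lt (Finset.card_le_card Finset.sdiff_subset)
    (Finset.card_lt_card (Finset.sdiff_ssubset ?_ ⟨s 0, ?_⟩))
  · exact Finset.image_subset_iff.mpr fun i hi => D.s_mem B hs (Finset.mem_range.mp hi).le
  · exact Finset.mem_image_of_mem s (Finset.mem_range.mpr hm)

end IsGoodDiagonal

namespace IsExactGrid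

theorem gridGraph_without_adj {a b c : S} :
    (gridGraph (Without c E) (Without c N)).Adj a b ↔ (gridGraph E N).Adj a b ∧ a ≠ c ∧ b ≠ c := by
  simp only [gridGraph_adj, Without]
  tauto

theorem hasReduction_of_isolated (G : IsExactGrid E N)
    (B : (gridGraph E N).IsBipartiteWith P Q) {c : S} (hc : c ∈ Q)
    (hadj : ∀ x, ¬ (gridGraph E N).Adj x c) (hE : ∀ x, ¬ E x c) :
    HasReduction E N P Q := by
  classical
  have hcP : c ∉ P := fun h => Set.disjoint_left.mp B.disjoint h hc
  have B' := isBipartiteWith_erase (E' := Without c E) (N' := Without c N) (c := c) (d := c) B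
    fun a b h => by
      obtain ⟨h, hac, -⟩ := gridGraph_without_adj.mp h
      exact ⟨h, hac, hac⟩
  rw [Finset.erase_eq_of_notMem hcP] at B'
  refine ⟨_, _, _, _, G.delete_of_not_west hE, B',
    Nat.add_lt_add_left (Finset.card_erase_lt_of_mem hc) _, fun h => ?_⟩
  refine .zero_col hc (fun x _ => gridMatrix_of_not_adj (hadj x)) (h.congr fun x hx y hy => ?_)
  refine gridMatrix_congr (Iff.trans ?_ gridGraph_without_adj.symm)
  exact (and_iff_left ⟨fun h => hcP (h ▸ hx), Finset.ne_of_mem_erase hy⟩).symm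

theorem hasReduction_of_leaf (G : IsExactGrid E N)
    (B : (gridGraph E N).IsBipartiteWith P Q) {c t : S} (hc : c ∈ Q) (ht : t ∈ P)
    (hadj : ∀ x, (gridGraph E N).Adj x c ↔ x = t) (hE : ∀ x, ¬ E x c) (hct : E c t) :
    HasReduction E N P Q := by
  classical
  have G' := (G.delete_of_not_west hE).delete_of_not_west (t := t)
    fun x h => h.2.1 (G.east.1 h.1 hct)
  have adj_iff : ∀ a b, (gridGraph (Without t (Without c E)) (Without t (Without c N))).Adj a b ↔
      ((gridGraph E N).Adj a b ∧ a ≠ c ∧ b ≠ c) ∧ a ≠ t ∧ b ≠ t := fun a b => by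
    rw [gridGraph_without_adj, gridGraph_without_adj]
  refine ⟨_, _, _, _, G', isBipartiteWith_erase (c := t) (d := c) B fun a b h => ?_,
    add_lt_add (Finset.card_erase_lt_of_mem ht) (Finset.card_erase_lt_of_mem hc), fun h => ?_⟩
  · obtain ⟨⟨h, hac, -⟩, hat, -⟩ := (adj_iff a b).mp h
    exact ⟨h, hat, hac⟩
  · refine .pivot ht hc (gridMatrix_of_adj ((hadj t).mpr rfl))
      (fun _ _ => gridMatrix_eq_zero_or _ _) (fun _ _ => gridMatrix_eq_zero_or _ _)
      (h.congr fun x hx y hy => ?_)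
    obtain ⟨hxt, hx⟩ := Finset.mem_erase.mp hx
    obtain ⟨hyc, hy⟩ := Finset.mem_erase.mp hy
    have hPQ : ∀ z ∈ P, z ∉ Q := fun z hz => Set.disjoint_left.mp B.disjoint hz
    rw [gridMatrix_of_not_adj (mt (hadj x).mp hxt), zero_mul, sub_zero]
    refine gridMatrix_congr (Iff.trans ?_ (adj_iff x y).symm)
    have : (x ≠ c ∧ y ≠ c) ∧ x ≠ t ∧ y ≠ t :=
      ⟨⟨fun h => hPQ x hx (h ▸ hc), hyc⟩, hxt, fun h => hPQ t ht (h ▸ hy)⟩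
    tauto

end IsExactGrid

theorem IsGoodDiagonal.hasReduction (D : IsGoodDiagonal E N m s t u)
    (B : (gridGraph E N).IsBipartiteWith P Q) (hs : s 0 ∈ Q) :
    HasReduction E N P Q := by
  rcases Nat.eq_zero_or_pos m with rfl | hm
  · have adj_iff : ∀ x, (gridGraph E N).Adj x (s 0) ↔ E (s 0) x := fun x => by
      refine ⟨?_, fun h => ⟨fun hx => D.not_west x (hx ▸ h), .inr (.inl h)⟩⟩
      rintro ⟨-, (h | h) | h | h⟩
      exacts [absurd h (D.not_west x), absurd h (D.not_south x), h, absurd h (D.not_north x)]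
    by_cases h : ∃ x, E (s 0) x
    · obtain ⟨x, hx⟩ := h
      exact D.hasReduction_of_leaf B hs (B.mem_of_mem_adj' hs ((adj_iff x).mpr hx))
        (fun y => (adj_iff y).trans ⟨(D.east.2 · hx), (· ▸ hx)⟩) D.not_west hx
    · exact D.hasReduction_of_isolated B hs (fun x => h ∘ Exists.intro x ∘ (adj_iff x).mp)
        D.not_west
  · exact D.hasReduction_of_lt B hs hm

theorem IsExactGrid.factorsOn (G : IsExactGrid E N) (B : (gridGraph E N).IsBipartiteWith P Q) :
    FactorsOn (gridMatrix E N) P Q := by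
  classical
  induction hn : P.card + Q.card using Nat.strong_induction_on generalizing E N P Q with
  | _ n ih =>
  subst hn
  have factorsOn_of_mem : ∀ {E' N'} {P' Q' : Finset S} {m s t u}, gridGraph E' N' = gridGraph E N →
      P'.card + Q'.card = P.card + Q.card → IsGoodDiagonal E' N' m s t u →
      (gridGraph E N).IsBipartiteWith P' Q' → s 0 ∈ Q' → FactorsOn (gridMatrix E N) P' Q' := by
    intro E' N' P' Q' m s t u hG hcard D B hs
    obtain ⟨E₁, N₁, P₁, Q₁, G₁, B₁, hlt, h⟩ := D.hasReduction (hG ▸ B) hs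
    have hM : gridMatrix E N = gridMatrix E' N' := by unfold gridMatrix; rw [hG]
    exact hM ▸ h (ih _ (hcard ▸ hlt) G₁ B₁ rfl)
  have factorsOn_of_isGoodDiagonal : ∀ {E' N' m s t u}, gridGraph E' N' = gridGraph E N →
      IsGoodDiagonal E' N' m s t u → s 0 ∈ P ∪ Q → FactorsOn (gridMatrix E N) P Q := by
    intro E' N' m s t u hG D hs
    rcases Finset.mem_union.mp hs with hs | hs
    · exact (factorsOn_of_mem hG (add_comm _ _) D B.symm hs).transpose.congr
        fun x _ y _ => gridMatrix_comm x y
    · exact factorsOn_of_mem hG rfl D B hs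
  have adj_mem : ∀ {a b}, (gridGraph E N).Adj a b → a ∈ P ∪ Q ∧ b ∈ P ∪ Q := fun {a b} h => by
    have := B.mem_of_adj h
    simp only [Finset.mem_coe] at this
    simp only [Finset.mem_union]
    tauto
  rcases (P ∪ Q).eq_empty_or_nonempty with hV | hV
  · obtain ⟨rfl, rfl⟩ := Finset.union_eq_empty.mp hV
    exact .empty
  obtain ⟨m, s, t, u, hs, D | D | D | D⟩ := G.exists_isGoodDiagonal hV
    (fun a b h => adj_mem ⟨G.ne_of_east h, .inl (.inl h)⟩)
    (fun a b h => adj_mem ⟨G.ne_of_north h, .inl (.inr h)⟩)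
  · exact factorsOn_of_isGoodDiagonal rfl D hs
  · exact factorsOn_of_isGoodDiagonal (gridGraph_swap ..) D hs
  · exact factorsOn_of_isGoodDiagonal (gridGraph_flip ..) D hs
  · exact factorsOn_of_isGoodDiagonal ((gridGraph_swap ..).trans (gridGraph_flip ..)) D hs

end Reduction

section PermutationPrimitive

variable {X A : Type*}

theorem exists_representative (r : Setoid X) (F : Set X) :
    ∃ c : X → X, (∀ x y, r x y → c x = c y) ∧ (∀ x, r (c x) x) ∧
      ∀ x y, r x y → y ∈ F → c x ∈ F := by
  have hex (q : Quotient r) :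
      ∃ b, Quotient.mk r b = q ∧ ∀ e, Quotient.mk r e = q → e ∈ F → b ∈ F := by
    by_cases h : ∃ e, Quotient.mk r e = q ∧ e ∈ F
    · exact h.imp fun e he => ⟨he.1, fun _ _ _ => he.2⟩
    · exact ⟨q.out, q.out_eq, fun e he heF => absurd ⟨e, he, heF⟩ h⟩
  choose b hb hbF using hex
  exact ⟨fun x => b ⟦x⟧, fun x y hxy => congrArg b (Quotient.sound hxy),
    fun x => Quotient.exact (hb ⟦x⟧),
    fun x y hxy hy => hbF ⟦x⟧ y (Quotient.sound (r.symm hxy)) hy⟩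

theorem minimalPeriod_eq_succ {f : X → X} {x : X} {n : ℕ} (h : f^[n + 1] x = x)
    (hmin : ∀ m < n, f^[m + 1] x ≠ x) : Function.minimalPeriod f x = n + 1 := by
  have hper : Function.IsPeriodicPt f (n + 1) x := h
  refine le_antisymm (hper.minimalPeriod_le n.succ_pos) (not_lt.mp fun hlt => ?_)
  obtain ⟨m, hm⟩ := Nat.exists_eq_succ_of_ne_zero (hper.minimalPeriod_pos n.succ_pos).ne'
  refine hmin m (by omega) ?_
  have := Function.isPeriodicPt_minimalPeriod f x
  rwa [hm] at this

theorem exists_primitive_of_sum_cycle_eq_zero [Finite X] [AddCommGroup A] (τ : Equiv.Perm X)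
    (F : Set X) (g : X → A)
    (hg : ∀ x, (∀ y, τ.SameCycle x y → y ∉ F) →
      ∑ i ∈ Finset.range (Function.minimalPeriod τ x), g (τ^[i] x) = 0) :
    ∃ l : X → A, ∀ x ∉ F, l (τ x) = l x + g x := by
  -- The primitive is a sum along the cycle, cut after an element of `F` if there is one.
  obtain ⟨c, hc_eq, hc, hcF⟩ := exists_representative (Equiv.Perm.SameCycle.setoid τ) F
  have hk (x : X) : ∃ k : ℕ, τ^[k + 1] (c x) = x ∧ ∀ m < k, τ^[m + 1] (c x) ≠ x := by
    obtain ⟨n, hn⟩ := (Equiv.Perm.sameCycle_apply_left.mpr (hc x)).exists_nat_pow_eq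
    rw [← Equiv.Perm.iterate_eq_pow, ← Function.iterate_succ_apply] at hn
    classical exact ⟨_, Nat.find_spec (p := fun m => τ^[m + 1] (c x) = x) ⟨n, hn⟩,
      fun m => Nat.find_min ⟨n, hn⟩⟩
  choose k hk hk_min using hk
  refine ⟨fun x => ∑ i ∈ Finset.range (k x), g (τ^[i + 1] (c x)), fun x hx => ?_⟩
  have hcτ : c (τ x) = c x := hc_eq _ _ (Equiv.Perm.sameCycle_apply_left.mpr .rfl)
  obtain hxc | hxc := eq_or_ne (c x) x
  · have hzero : k (τ x) = 0 := Nat.eq_zero_of_not_pos fun hpos =>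
      hk_min (τ x) 0 hpos (by rw [hcτ, hxc, Function.iterate_one])
    have hsum := hg x fun y hxy hy => hx (hxc ▸ hcF x y hxy hy)
    have hperiod : Function.minimalPeriod τ x = k x + 1 :=
      minimalPeriod_eq_succ (by simpa only [hxc] using hk x) (by simpa only [hxc] using hk_min x)
    rw [hperiod, Finset.sum_range_succ', Function.iterate_zero_apply] at hsum
    simpa only [hzero, hxc, Finset.sum_range_zero] using hsum.symm
  · have hsucc : k (τ x) = k x + 1 := by
      have hτ (m : ℕ) : τ^[m + 1] (c (τ x)) = τ x ↔ τ^[m] (c x) = x := by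
        rw [hcτ, Function.iterate_succ_apply', τ.injective.eq_iff]
      refine le_antisymm (not_lt.mp fun hlt => hk_min _ _ hlt ((hτ _).mpr (hk x))) ?_
      obtain ⟨m, hm⟩ : ∃ m, k (τ x) = m + 1 := Nat.exists_eq_succ_of_ne_zero fun h0 =>
        hxc ((hτ 0).mp (h0 ▸ hk (τ x)))
      rw [hm, Nat.succ_le_succ_iff]
      exact not_lt.mp fun hlt => hk_min x m hlt ((hτ _).mp (hm ▸ hk (τ x)))
    simp only [hsucc, hcτ, Finset.sum_range_succ, hk]

end PermutationPrimitive

namespace SquareGluing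

variable {S : Type*} (G : SquareGluing S)

/-- The passage from a corner across the side that starts there to the next corner at the same
vertex; if this side is not glued, it leads to the end of the side instead, so that the cycles of
the permutation run through the corners at an interior vertex, but along the boundary elsewhere. -/
def rotate : Equiv.Perm (S × Fin 4) where
  toFun d := ((G.mate d).1, (G.mate d).2 + 1)
  invFun d := G.mate (d.1, d.2 - 1)
  left_inv d := by simp [G.mate_mate]
  right_inv d := by simp [G.mate_mate]

/-- The corners reached from `d` by rotation start sides that are glued, so that `d` lies at an
interior vertex. -/
def IsInteriorCorner (d : S × Fin 4) : Prop :=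
  ∀ e, G.rotate.SameCycle d e → G.mate e ≠ e

/-- The values `val v` on the squares at the vertex `v` form a primitive of the cochain `g` across
the sides that end at `v`. -/
def IsVertexPotential {A : Type*} [AddCommGroup A] (g : S × Fin 4 → A) (val : G.Vertex → S → A) :
    Prop :=
  ∀ d, G.mate d ≠ d → ∀ v, v = G.vertex d.1 d.2 ∨ v = G.vertex d.1 (d.2 + 1) →
    val v (G.mate d).1 = val v d.1 + g d

variable {G}

theorem fst_rotate (d : S × Fin 4) : (G.rotate d).1 = (G.mate d).1 := rfl

theorem rotate_mate (d : S × Fin 4) : G.rotate (G.mate d) = (d.1, d.2 + 1) := by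
  change ((G.mate (G.mate d)).1, (G.mate (G.mate d)).2 + 1) = _
  rw [G.mate_mate]

theorem mate_mate_ne {d : S × Fin 4} (hd : G.mate d ≠ d) : G.mate (G.mate d) ≠ G.mate d := by
  rw [G.mate_mate]
  exact hd.symm

theorem vertex_mate {d : S × Fin 4} (hd : G.mate d ≠ d) :
    G.vertex (G.mate d).1 ((G.mate d).2 + 1) = G.vertex d.1 d.2 :=
  (Quot.sound (CornerRel.glue d hd)).symm

theorem vertex_mate' {d : S × Fin 4} (hd : G.mate d ≠ d) :
    G.vertex (G.mate d).1 (G.mate d).2 = G.vertex d.1 (d.2 + 1) := by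
  have h := G.vertex_mate (mate_mate_ne hd)
  rw [G.mate_mate] at h
  exact h.symm

theorem sameCycle_of_vertex_eq {d e : S × Fin 4} (h : G.vertex d.1 d.2 = G.vertex e.1 e.2) :
    G.rotate.SameCycle d e := by
  have hrel (x y : S × Fin 4) (hxy : G.CornerRel x y) :
      Quotient.mk (Equiv.Perm.SameCycle.setoid G.rotate) x = Quotient.mk _ y := by
    obtain ⟨hd⟩ := hxy
    exact Quotient.sound (Equiv.Perm.sameCycle_apply_right.mpr .rfl)
  exact Quotient.exact (congrArg (Quot.lift _ hrel) h)

namespace IsInteriorCorner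

variable {d : S × Fin 4}

theorem mate_ne (hd : G.IsInteriorCorner d) : G.mate d ≠ d := hd d .rfl

theorem rotate (hd : G.IsInteriorCorner d) : G.IsInteriorCorner (G.rotate d) := fun e he =>
  hd e (Equiv.Perm.sameCycle_apply_left.mp he)

theorem vertex_iterate_rotate (hd : G.IsInteriorCorner d) (n : ℕ) :
    G.vertex (G.rotate^[n] d).1 (G.rotate^[n] d).2 = G.vertex d.1 d.2 := by
  induction n generalizing d with
  | zero => rfl
  | succ n ih => exact (ih hd.rotate).trans (vertex_mate hd.mate_ne)

theorem isInterior (hd : G.IsInteriorCorner d) : G.IsInterior (G.vertex d.1 d.2) := by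
  refine fun s k hk => ⟨fun h => hd (s, k) (sameCycle_of_vertex_eq h) hk, fun h => ?_⟩
  have hrot : G.rotate (s, k) = (s, k + 1) := hk ▸ rotate_mate (s, k)
  exact hd (s, k) (Equiv.Perm.sameCycle_apply_right.mp
    (hrot ▸ sameCycle_of_vertex_eq (e := (s, k + 1)) h)) hk

end IsInteriorCorner

theorem exists_corner_potential [Finite S] {A : Type*} [AddCommGroup A] (g : S × Fin 4 → A)
    (hsum : ∀ d, G.IsInteriorCorner d →
      ∑ i ∈ Finset.range (Function.minimalPeriod G.rotate d), g (G.rotate^[i] d) = 0) :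
    ∃ l : S × Fin 4 → A, ∀ d, G.mate d ≠ d → l (G.rotate d) = l d + g d :=
  exists_primitive_of_sum_cycle_eq_zero G.rotate {d | G.mate d = d} g hsum

end SquareGluing

namespace QuadriculatedDisk

variable {S : Type*} (Δ : QuadriculatedDisk S)

theorem minimalPeriod_rotate [Finite S] {d : S × Fin 4} (hd : Δ.IsInteriorCorner d) :
    Function.minimalPeriod Δ.rotate d = 4 := by
  set p := Function.minimalPeriod Δ.rotate d with hp
  have hsquares : Δ.squaresAt (Δ.vertex d.1 d.2) = (fun n => (Δ.rotate^[n] d).1) '' Set.Iio p := by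
    ext s
    refine ⟨fun ⟨k, hk⟩ => ?_, ?_⟩
    · obtain ⟨n, hn⟩ :=
        (SquareGluing.sameCycle_of_vertex_eq (e := (s, k)) hk.symm).exists_nat_pow_eq
      refine ⟨n % p, Nat.mod_lt _ (Function.minimalPeriod_pos_of_mem_periodicPts
        (Δ.rotate.injective.mem_periodicPts d)), ?_⟩
      dsimp only
      rw [hp, Function.iterate_mod_minimalPeriod_eq, Equiv.Perm.iterate_eq_pow, hn]
    · rintro ⟨n, _, rfl⟩
      exact ⟨_, hd.vertex_iterate_rotate n⟩
  have hinj : Set.InjOn (fun n => (Δ.rotate^[n] d).1) (Set.Iio p) := by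
    intro m hm n hn (hmn : (Δ.rotate^[m] d).1 = (Δ.rotate^[n] d).1)
    refine Function.iterate_injOn_Iio_minimalPeriod hm hn
      (Prod.ext hmn (Δ.vertex_injective (Δ.rotate^[m] d).1 ?_))
    rw [hd.vertex_iterate_rotate m, hmn, hd.vertex_iterate_rotate n]
  have hfour := Δ.interior_four _ hd.isInterior
  rw [hsquares, hinj.ncard_image] at hfour
  simpa using hfour

theorem iterate_four_rotate [Finite S] {d : S × Fin 4} (hd : Δ.IsInteriorCorner d) :
    Δ.rotate^[4] d = d := by
  have h := Function.isPeriodicPt_minimalPeriod Δ.rotate d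
  rwa [Δ.minimalPeriod_rotate hd] at h

theorem exists_vertex_potential [Finite S] {A : Type*} [AddCommGroup A] {g : S × Fin 4 → A}
    (hg : ∀ d, Δ.mate d ≠ d → g (Δ.mate d) = -g d)
    (hsum : ∀ d, Δ.IsInteriorCorner d → ∑ i ∈ Finset.range 4, g (Δ.rotate^[i] d) = 0) :
    ∃ val : Δ.Vertex → S → A, Δ.IsVertexPotential g val := by
  obtain ⟨l, hl⟩ := SquareGluing.exists_corner_potential g fun d hd => by
    rw [Δ.minimalPeriod_rotate hd]
    exact hsum d hd
  have hval (v : Δ.Vertex) (s : S) : ∃ a, ∀ k, Δ.vertex s k = v → l (s, k) = a :=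
    exists_const_of_forall_eq fun j k hj hk => by rw [Δ.vertex_injective s (hj.trans hk.symm)]
  choose val hval using hval
  refine ⟨val, ?_⟩
  rintro d hd _ (rfl | rfl)
  · rw [← hval _ _ _ (Δ.vertex_mate hd), ← hval _ _ _ rfl]
    exact hl d hd
  · have h := hl _ (SquareGluing.mate_mate_ne hd)
    rw [SquareGluing.rotate_mate, hg d hd] at h
    rw [← hval _ _ _ (Δ.vertex_mate' hd), ← hval _ _ _ rfl, h, neg_add_cancel_right]

end QuadriculatedDisk

/-- The open star of a corner of the model square: the complement of the sides that do not
contain it. -/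
def cornerStar : Fin 4 → Set (I × I)
  | 0 => {p | p.1 ≠ 1 ∧ p.2 ≠ 1}
  | 1 => {p | p.1 ≠ 0 ∧ p.2 ≠ 1}
  | 2 => {p | p.1 ≠ 0 ∧ p.2 ≠ 0}
  | 3 => {p | p.1 ≠ 1 ∧ p.2 ≠ 0}

theorem isOpen_cornerStar (k : Fin 4) : IsOpen (cornerStar k) := by
  have h₁ (a : I) : IsOpen {p : I × I | p.1 ≠ a} := isOpen_ne.preimage continuous_fst
  have h₂ (a : I) : IsOpen {p : I × I | p.2 ≠ a} := isOpen_ne.preimage continuous_snd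
  fin_cases k
  · exact (h₁ 1).inter (h₂ 1)
  · exact (h₁ 0).inter (h₂ 1)
  · exact (h₁ 0).inter (h₂ 0)
  · exact (h₁ 1).inter (h₂ 0)

theorem exists_mem_cornerStar (p : I × I) : ∃ k, p ∈ cornerStar k := by
  by_cases h₁ : p.1 = 0 <;> by_cases h₂ : p.2 = 0
  · exact ⟨0, by simp [cornerStar, h₁, h₂]⟩
  · exact ⟨3, by simp [cornerStar, h₁, h₂]⟩
  · exact ⟨1, by simp [cornerStar, h₁, h₂]⟩
  · exact ⟨2, by simp [cornerStar, h₁, h₂]⟩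

theorem sidePoint_mem_cornerStar (k j : Fin 4) (t : I) :
    sidePoint k t ∈ cornerStar j ↔ j = k ∧ t ≠ 1 ∨ j = k + 1 ∧ t ≠ 0 := by
  fin_cases k <;> fin_cases j <;> simp [sidePoint, cornerStar, unitInterval.symm_eq_zero,
    unitInterval.symm_eq_one]

theorem exists_forall_eq_of_locally_eq {X A ι : Type*} [TopologicalSpace X] [PreconnectedSpace X]
    [Nonempty X] [TopologicalSpace A] [DiscreteTopology A] {U : ι → Set X} {f : ι → X → A}
    (hU : ∀ i, IsOpen (U i)) (hcov : ∀ x, ∃ i, x ∈ U i) (hf : ∀ i, ContinuousOn (f i) (U i))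
    (heq : ∀ i j x, x ∈ U i → x ∈ U j → f i x = f j x) : ∃ c, ∀ i, ∀ x ∈ U i, f i x = c := by
  choose idx hidx using hcov
  have hcont : Continuous fun x => f (idx x) x := continuous_iff_continuousAt.mpr fun x =>
    ((hf (idx x)).continuousAt ((hU _).mem_nhds (hidx x))).congr
      (Filter.mem_of_superset ((hU _).mem_nhds (hidx x)) fun y hy => heq _ _ y hy (hidx y))
  obtain ⟨x₀⟩ := ‹Nonempty X›
  exact ⟨f (idx x₀) x₀, fun i x hx =>
    (heq i _ x hx (hidx x)).trans (PreconnectedSpace.constant ‹_› hcont)⟩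

namespace SquareGluing

variable {S : Type*} (G : SquareGluing S)

/-- The point `p` of the square `s`. -/
def point (s : S) (p : I × I) : G.Realization := Quot.mk _ ⟨s, p⟩

variable {G}

theorem point_sidePoint_mate {d : S × Fin 4} (hd : G.mate d ≠ d) (t : I) :
    G.point (G.mate d).1 (sidePoint (G.mate d).2 (unitInterval.symm t)) =
      G.point d.1 (sidePoint d.2 t) :=
  (Quot.sound (PointRel.glue d hd t)).symm

theorem continuous_point (s : S) : Continuous (G.point s) :=
  continuous_quot_mk.comp continuous_sigmaMk

theorem isOpen_iff_preimage_point {W : Set G.Realization} :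
    IsOpen W ↔ ∀ s, IsOpen (G.point s ⁻¹' W) := by
  rw [← isQuotientMap_quot_mk.isOpen_preimage, isOpen_sigma_iff]
  rfl

theorem continuousOn_of_comp_point {Y : Type*} [TopologicalSpace Y] {W : Set G.Realization}
    (hW : IsOpen W) {f : G.Realization → Y}
    (hf : ∀ s, ContinuousOn (f ∘ G.point s) (G.point s ⁻¹' W)) : ContinuousOn f W := by
  rw [continuousOn_open_iff hW]
  refine fun V hV => isOpen_iff_preimage_point.mpr fun s => ?_
  exact (hf s).isOpen_inter_preimage (hW.preimage (continuous_point s)) hV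

theorem exists_corner_sidePoint_iff {v : G.Vertex} {s : S} {k : Fin 4} {t : I} :
    (∃ j, G.vertex s j = v ∧ sidePoint k t ∈ cornerStar j) ↔
      G.vertex s k = v ∧ t ≠ 1 ∨ G.vertex s (k + 1) = v ∧ t ≠ 0 := by
  simp only [sidePoint_mem_cornerStar, and_or_left, exists_or]
  grind

variable (G) in
/-- The open star of a vertex: the union of the open stars of the corners at it. -/
def star (v : G.Vertex) : Set G.Realization :=
  {x | Quot.lift (fun q : Σ _ : S, I × I => ∃ k, G.vertex q.1 k = v ∧ q.2 ∈ cornerStar k)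
    (by
      rintro _ _ ⟨d, hd, t⟩
      simp only [exists_corner_sidePoint_iff, vertex_mate hd, vertex_mate' hd, ne_eq,
        unitInterval.symm_eq_one, unitInterval.symm_eq_zero]
      exact propext or_comm)
    x}

theorem point_mem_star {v : G.Vertex} {s : S} {p : I × I} :
    G.point s p ∈ G.star v ↔ ∃ k, G.vertex s k = v ∧ p ∈ cornerStar k := Iff.rfl

theorem eq_vertex_of_sidePoint_mem_star {v : G.Vertex} {d : S × Fin 4} {t : I}
    (h : G.point d.1 (sidePoint d.2 t) ∈ G.star v) :
    v = G.vertex d.1 d.2 ∨ v = G.vertex d.1 (d.2 + 1) :=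
  (exists_corner_sidePoint_iff.mp (point_mem_star.mp h)).imp (·.1.symm) (·.1.symm)

theorem isOpen_star (v : G.Vertex) : IsOpen (G.star v) := by
  refine isOpen_iff_preimage_point.mpr fun s => ?_
  have hpre : G.point s ⁻¹' G.star v = ⋃ (k) (_ : G.vertex s k = v), cornerStar k := by
    ext p
    simp [point_mem_star]
  rw [hpre]
  exact isOpen_iUnion fun k => isOpen_iUnion fun _ => isOpen_cornerStar k

theorem exists_mem_star (x : G.Realization) : ∃ v, x ∈ G.star v := by
  obtain ⟨s, p⟩ := x
  exact (exists_mem_cornerStar p).elim fun k hk => ⟨G.vertex s k, k, rfl, hk⟩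

section Potential

variable {A : Type*} [AddCommGroup A] {g : S × Fin 4 → A} {val : G.Vertex → S → A}

theorem exists_transition (hval : G.IsVertexPotential g val) :
    ∃ T : G.Vertex → G.Vertex → G.Realization → A, ∀ v w s p, G.point s p ∈ G.star v →
      G.point s p ∈ G.star w → T v w (G.point s p) = val w s - val v s := by
  classical
  refine ⟨fun v w => Quot.lift (fun q => if G.point q.1 q.2 ∈ G.star v ∩ G.star w then
    val w q.1 - val v q.1 else 0) ?_, fun v w s p hv hw => if_pos ⟨hv, hw⟩⟩
  rintro _ _ ⟨d, hd, t⟩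
  dsimp only
  rw [point_sidePoint_mate hd]
  split_ifs with h
  · rw [hval d hd v (eq_vertex_of_sidePoint_mem_star h.1),
      hval d hd w (eq_vertex_of_sidePoint_mem_star h.2), add_sub_add_right_eq_sub]
  · rfl

theorem exists_potential_of_vertex_potential [ContractibleSpace G.Realization]
    (hval : G.IsVertexPotential g val) :
    ∃ h : S → A, ∀ d, G.mate d ≠ d → h (G.mate d).1 = h d.1 + g d := by
  let _ : TopologicalSpace A := ⊥
  have : DiscreteTopology A := ⟨rfl⟩
  obtain ⟨T, hT⟩ := exists_transition hval
  have hTcont (v w : G.Vertex) : ContinuousOn (T v w) (G.star v ∩ G.star w) :=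
    continuousOn_of_comp_point ((isOpen_star v).inter (isOpen_star w)) fun s =>
      (continuousOn_const (c := val w s - val v s)).congr fun p hp => hT v w s p hp.1 hp.2
  obtain ⟨φ, hφ, hφT⟩ := exists_coboundary_of_cocycle isOpen_star exists_mem_star hTcont
    fun u v w x hu hv hw => by
      obtain ⟨s, p⟩ := x
      rw [← point, hT u v s p hu hv, hT v w s p hv hw, hT u w s p hu hw, sub_add_sub_cancel']
  have hconst (s : S) :
      ∃ c, ∀ v, ∀ p ∈ G.point s ⁻¹' G.star v, φ v (G.point s p) - val v s = c := by
    refine exists_forall_eq_of_locally_eq (fun v => (isOpen_star v).preimage (continuous_point s))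
      (fun p => exists_mem_star (G.point s p)) (fun v => ?_) fun v w p hv hw => ?_
    · exact ((hφ v).comp (continuous_point s).continuousOn fun p hp => hp).sub continuousOn_const
    · rw [hφT v w _ hv hw, hT v w s p hv hw]
      abel
  choose c hc using hconst
  refine ⟨fun s => -c s, fun d hd => ?_⟩
  have hmem : G.point d.1 (sidePoint d.2 0) ∈ G.star (G.vertex d.1 d.2) :=
    exists_corner_sidePoint_iff.mpr (Or.inl ⟨rfl, zero_ne_one⟩)
  have hmem' := hmem
  rw [← point_sidePoint_mate hd] at hmem'
  dsimp only
  rw [← hc _ _ _ hmem, ← hc _ _ _ hmem', point_sidePoint_mate hd, hval d hd _ (Or.inl rfl)]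
  abel

end Potential

end SquareGluing

namespace QuadriculatedDisk

variable {S : Type*} (Δ : QuadriculatedDisk S)

instance : ContractibleSpace Δ.Realization := by
  obtain ⟨e⟩ := Δ.isDisk
  have : ContractibleSpace (Metric.closedBall (0 : EuclideanSpace ℝ (Fin 2)) 1) :=
    Metric.contractibleSpace_closedBall zero_le_one
  exact e.contractibleSpace

theorem exists_potential [Finite S] {A : Type*} [AddCommGroup A] {g : S × Fin 4 → A}
    (hg : ∀ d, Δ.mate d ≠ d → g (Δ.mate d) = -g d)
    (hsum : ∀ d, Δ.IsInteriorCorner d → ∑ i ∈ Finset.range 4, g (Δ.rotate^[i] d) = 0) :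
    ∃ h : S → A, ∀ d, Δ.mate d ≠ d → h (Δ.mate d).1 = h d.1 + g d :=
  (Δ.exists_vertex_potential hg hsum).elim fun _ hval =>
    SquareGluing.exists_potential_of_vertex_potential hval

end QuadriculatedDisk

theorem sum_range_iterate_apply_self {X A : Type*} [AddCommGroup A] {f : X → X} {n : ℕ} {x : X}
    (h : f^[n] x = x) (g : X → A) :
    ∑ i ∈ Finset.range n, g (f^[i] (f x)) = ∑ i ∈ Finset.range n, g (f^[i] x) := by
  have hsum := Finset.sum_range_succ' (fun i => g (f^[i] x)) n
  rw [Finset.sum_range_succ, h] at hsum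
  exact (add_right_cancel hsum).symm

namespace SquareGluing

variable {S : Type*} (G : SquareGluing S) (a : S → Fin 4)

/-- The direction in which the side `d` lies after the square containing it has been turned by the
angle `a` assigned to it: `0`, `1`, `2` and `3` stand for east, north, west and south. -/
def direction (a : S → Fin 4) (d : S × Fin 4) : Fin 4 := d.2 + a d.1

/-- The squares, turned by `a`, fit together by translations: sides glued to each other lie in
opposite directions. -/
def IsOrientation : Prop := ∀ d, G.mate d ≠ d → direction a (G.mate d) = direction a d + 2

/-- The square `t` is the neighbor of `s` in the direction `k`, the squares being turned by `a`. -/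
def Neighbor (k : Fin 4) (s t : S) : Prop :=
  ∃ d, G.mate d ≠ d ∧ d.1 = s ∧ (G.mate d).1 = t ∧ direction a d = k

variable {G a}

theorem IsOrientation.direction_rotate (ha : G.IsOrientation a) {d : S × Fin 4}
    (hd : G.mate d ≠ d) : direction a (G.rotate d) = direction a d - 1 := by
  change (G.mate d).2 + 1 + a (G.mate d).1 = _
  have h : (G.mate d).2 + a (G.mate d).1 = direction a d + 2 := ha d hd
  rw [add_right_comm, h, add_assoc, sub_eq_add_neg]
  rfl

theorem neighbor_rotate {d : S × Fin 4} (hd : G.mate d ≠ d) :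
    G.Neighbor a (direction a d) d.1 (G.rotate d).1 := ⟨d, hd, rfl, rfl, rfl⟩

theorem Neighbor.symm {k : Fin 4} {s t : S} (h : G.Neighbor a k s t) (ha : G.IsOrientation a) :
    G.Neighbor a (k + 2) t s := by
  obtain ⟨d, hd, rfl, rfl, rfl⟩ := h
  exact ⟨G.mate d, mate_mate_ne hd, rfl, by rw [G.mate_mate], ha d hd⟩

theorem neighbor_rightUnique (k : Fin 4) : Relator.RightUnique (G.Neighbor a k) := by
  rintro _ _ _ ⟨d, -, rfl, rfl, hk⟩ ⟨d', -, hd, rfl, hk'⟩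
  have hdd : d' = d := Prod.ext hd (add_right_cancel (b := a d.1)
    ((hd ▸ hk' : d'.2 + a d.1 = k).trans hk.symm))
  rw [hdd]

theorem IsOrientation.neighbor_biUnique (ha : G.IsOrientation a) (k : Fin 4) :
    Relator.BiUnique (G.Neighbor a k) :=
  ⟨fun _ _ _ h h' => neighbor_rightUnique _ (h.symm ha) (h'.symm ha), neighbor_rightUnique k⟩

theorem IsInteriorCorner.direction_iterate_rotate {d : S × Fin 4} (hd : G.IsInteriorCorner d)
    (ha : G.IsOrientation a) (n : ℕ) :
    direction a (G.rotate^[n] d) = direction a d - n • 1 := by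
  induction n generalizing d with
  | zero => exact ((congrArg _ (zero_nsmul _)).trans (sub_zero _)).symm
  | succ n ih =>
    rw [Function.iterate_succ_apply, ih hd.rotate, ha.direction_rotate hd.mate_ne, sub_sub,
      succ_nsmul']

theorem IsInteriorCorner.direction_iterate_rotate_of_eq_one {d : S × Fin 4}
    (hd : G.IsInteriorCorner d) (ha : G.IsOrientation a) (hdir : direction a d = 1) :
    direction a (G.rotate d) = 0 ∧ direction a (G.rotate^[2] d) = 3 ∧
      direction a (G.rotate^[3] d) = 2 := by
  have h (n : ℕ) : direction a (G.rotate^[n] d) = 1 - n • 1 :=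
    hdir ▸ hd.direction_iterate_rotate ha n
  exact ⟨h 1, h 2, h 3⟩

theorem IsInteriorCorner.isBlock {d : S × Fin 4} (hd : G.IsInteriorCorner d)
    (ha : G.IsOrientation a) (hfour : G.rotate^[4] d = d) (hdir : direction a d = 1) :
    IsBlock (G.Neighbor a 0) (G.Neighbor a 1) d.1 (G.rotate^[3] d).1 (G.rotate^[2] d).1
      (G.rotate d).1 := by
  obtain ⟨h₁, h₂, h₃⟩ := hd.direction_iterate_rotate_of_eq_one ha hdir
  have hnorth : G.Neighbor a 1 d.1 (G.rotate d).1 := hdir ▸ neighbor_rotate hd.mate_ne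
  have heast : G.Neighbor a 0 (G.rotate d).1 (G.rotate^[2] d).1 :=
    h₁ ▸ neighbor_rotate hd.rotate.mate_ne
  have hsouth : G.Neighbor a 3 (G.rotate^[2] d).1 (G.rotate^[3] d).1 :=
    h₂ ▸ neighbor_rotate hd.rotate.rotate.mate_ne
  have hwest : G.Neighbor a 2 (G.rotate^[3] d).1 (G.rotate^[4] d).1 :=
    h₃ ▸ neighbor_rotate hd.rotate.rotate.rotate.mate_ne
  rw [hfour] at hwest
  exact ⟨hwest.symm ha, hsouth.symm ha, hnorth, heast⟩

theorem exists_neighbor_of_adj {s t : S} (h : G.Adj s t) : ∃ k, G.Neighbor a k s t := by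
  obtain ⟨hne, k, l, h⟩ := h
  exact ⟨k + a s, (s, k), fun h' => hne (congrArg Prod.fst (h'.symm.trans h)), rfl, by rw [h], rfl⟩

/-- The cochain on pairs of neighbors with values `f` towards the east and `g` towards the north,
as a function of the direction. -/
def directedCochain {A : Type*} [AddCommGroup A] (f g : S → S → A) : Fin 4 → S → S → A
  | 0, s, t => f s t
  | 1, s, t => g s t
  | 2, s, t => -f t s
  | 3, s, t => -g t s

variable (G a) in
/-- The cochain on sides that corresponds to `directedCochain`. -/
def sideCochain {A : Type*} [AddCommGroup A] (f g : S → S → A) (d : S × Fin 4) : A :=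
  directedCochain f g (direction a d) d.1 (G.mate d).1

section Cochain

variable {A : Type*} [AddCommGroup A] {f g : S → S → A} {d : S × Fin 4}

theorem directedCochain_add_two (k : Fin 4) (s t : S) :
    directedCochain f g (k + 2) t s = -directedCochain f g k s t := by
  fin_cases k
  · rfl
  · rfl
  · exact (neg_neg _).symm
  · exact (neg_neg _).symm

theorem sideCochain_mate (ha : G.IsOrientation a) (hd : G.mate d ≠ d) :
    G.sideCochain a f g (G.mate d) = -G.sideCochain a f g d := by
  rw [sideCochain, G.mate_mate, ha d hd, directedCochain_add_two]
  rfl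

theorem IsInteriorCorner.sum_sideCochain_eq_zero_of_direction_eq_one (hd : G.IsInteriorCorner d)
    (ha : G.IsOrientation a) (hfour : G.rotate^[4] d = d) (hdir : direction a d = 1)
    (hclosed : ∀ s t x y, IsBlock (G.Neighbor a 0) (G.Neighbor a 1) s t x y →
      f s t + g t x = g s y + f y x) :
    ∑ i ∈ Finset.range 4, G.sideCochain a f g (G.rotate^[i] d) = 0 := by
  obtain ⟨h₁, h₂, h₃⟩ := hd.direction_iterate_rotate_of_eq_one ha hdir
  have hfour' : G.rotate (G.rotate^[3] d) = d := hfour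
  have hnorth : G.sideCochain a f g d = g d.1 (G.rotate d).1 := by rw [sideCochain, hdir]; rfl
  have heast : G.sideCochain a f g (G.rotate d) = f (G.rotate d).1 (G.rotate^[2] d).1 := by
    rw [sideCochain, h₁]; rfl
  have hsouth : G.sideCochain a f g (G.rotate^[2] d) =
      -g (G.rotate^[3] d).1 (G.rotate^[2] d).1 := by rw [sideCochain, h₂]; rfl
  have hwest : G.sideCochain a f g (G.rotate^[3] d) = -f d.1 (G.rotate^[3] d).1 := by
    rw [sideCochain, h₃, ← fst_rotate, hfour']; rfl
  rw [Finset.sum_range_succ, Finset.sum_range_succ, Finset.sum_range_succ, Finset.sum_range_one,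
    Function.iterate_zero_apply, Function.iterate_one, hnorth, heast, hsouth, hwest,
    ← hclosed _ _ _ _ (hd.isBlock ha hfour hdir)]
  abel

end Cochain

end SquareGluing

namespace QuadriculatedDisk

variable {S : Type*} [Finite S] (Δ : QuadriculatedDisk S)

theorem exists_orientation : ∃ a : S → Fin 4, Δ.IsOrientation a := by
  have hanti (x y : Fin 4) : x - y + 2 = -(y - x + 2) := by
    revert x y
    decide
  obtain ⟨a, ha⟩ := Δ.exists_potential (g := fun d => d.2 - (Δ.mate d).2 + 2)
    (fun d _ => by rw [Δ.mate_mate, hanti]) fun d hd => by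
    -- The differences telescope along the cycle of length `4`, and `4 * (1 + 2) = 0`.
    have hstep (i : ℕ) : (Δ.rotate^[i] d).2 - (Δ.mate (Δ.rotate^[i] d)).2 + 2 =
        (Δ.rotate^[i] d).2 - (Δ.rotate^[i + 1] d).2 + 3 := by
      rw [Function.iterate_succ_apply']
      change _ = _ - ((Δ.mate (Δ.rotate^[i] d)).2 + 1) + 3
      rw [sub_add_eq_sub_sub, sub_add _ 1 3, sub_eq_add_neg _ (1 - 3)]
      rfl
    rw [Finset.sum_congr rfl fun i _ => hstep i, Finset.sum_add_distrib, Finset.sum_range_sub',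
      Δ.iterate_four_rotate hd, Function.iterate_zero_apply, sub_self]
    rfl
  refine ⟨a, fun d hd => ?_⟩
  rw [SquareGluing.direction, ha d hd, SquareGluing.direction]
  abel

variable {Δ} {a : S → Fin 4}

theorem sum_sideCochain_eq_zero (ha : Δ.IsOrientation a) {A : Type*} [AddCommGroup A]
    {f g : S → S → A} {d : S × Fin 4} (hd : Δ.IsInteriorCorner d)
    (hclosed : ∀ s t x y, IsBlock (Δ.Neighbor a 0) (Δ.Neighbor a 1) s t x y →
      f s t + g t x = g s y + f y x) :
    ∑ i ∈ Finset.range 4, Δ.sideCochain a f g (Δ.rotate^[i] d) = 0 := by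
  have hshift (n : ℕ) (hn : SquareGluing.direction a (Δ.rotate^[n] d) = 1) :
      ∑ i ∈ Finset.range 4, Δ.sideCochain a f g (Δ.rotate^[i] d) = 0 := by
    induction n generalizing d with
    | zero =>
      exact hd.sum_sideCochain_eq_zero_of_direction_eq_one ha (Δ.iterate_four_rotate hd) hn hclosed
    | succ n ih =>
      rw [← sum_range_iterate_apply_self (Δ.iterate_four_rotate hd)]
      exact ih hd.rotate hn
  have hex (x : Fin 4) : x - (x - 1).val • 1 = 1 := by
    revert x
    decide
  exact hshift _ ((hd.direction_iterate_rotate ha _).trans (hex (SquareGluing.direction a d)))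

end QuadriculatedDisk

namespace SquareGluing

variable {S : Type*} {G : SquareGluing S} {a : S → Fin 4}

theorem Neighbor.adj {k : Fin 4} {s t : S} (h : G.Neighbor a k s t) (hst : s ≠ t) : G.Adj s t := by
  obtain ⟨d, -, rfl, rfl, -⟩ := h
  exact ⟨hst, d.2, (G.mate d).2, rfl⟩

theorem IsOrientation.adj_iff (ha : G.IsOrientation a) {s t : S} :
    G.Adj s t ↔ (gridGraph (G.Neighbor a 0) (G.Neighbor a 1)).Adj s t := by
  rw [gridGraph_adj]
  refine ⟨fun h => ⟨h.1, ?_⟩, fun ⟨hst, h⟩ => ?_⟩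
  · obtain ⟨k, hk⟩ := exists_neighbor_of_adj (a := a) h
    match k with
    | 0 => exact .inl (.inl hk)
    | 1 => exact .inl (.inr hk)
    | 2 => exact .inr (.inl (hk.symm ha))
    | 3 => exact .inr (.inr (hk.symm ha))
  · rcases h with (h | h) | h | h
    exacts [h.adj hst, h.adj hst, (h.symm ha).adj hst, (h.symm ha).adj hst]

theorem IsBicoloring.isBipartiteWith [Fintype S] {H : SimpleGraph S} {c : S → Bool}
    (hc : G.IsBicoloring c) (hadj : ∀ s t, H.Adj s t → G.Adj s t) :
    H.IsBipartiteWith (Finset.univ.filter (c · = true) : Finset S)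
      (Finset.univ.filter (c · = false) : Finset S) where
  disjoint := Finset.disjoint_coe.mpr (Finset.disjoint_filter.mpr fun s _ h h' => by simp_all)
  mem_of_adj s t hst := by
    have hne := hc s t (hadj s t hst)
    cases hs : c s <;> cases ht : c t <;> simp_all

open Classical in
theorem IsOrientation.blackToWhite_eq (ha : G.IsOrientation a) {c : S → Bool} {b w : ℕ}
    (β : Fin b ≃ {s // c s = true}) (ω : Fin w ≃ {s // c s = false}) :
    G.blackToWhite β ω =
      Matrix.of fun i j => gridMatrix (G.Neighbor a 0) (G.Neighbor a 1) (β i) (ω j) := by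
  ext i j
  exact if_congr ha.adj_iff rfl rfl

end SquareGluing

theorem IsExactGrid.exists_coloring {S : Type*} {E N : S → S → Prop} (G : IsExactGrid E N) :
    ∃ c : S → Bool, ∀ s t, (gridGraph E N).Adj s t → c s ≠ c t := by
  obtain ⟨X, Y, hE, hN⟩ := G.exists_position
  have hstep (s t : S) (h : E s t ∨ N s t) : X t + Y t = X s + Y s + 1 := by
    obtain h | h := h
    · rw [(hE s t h).1, (hE s t h).2, add_right_comm]
    · rw [(hN s t h).1, (hN s t h).2, add_assoc]
  refine ⟨fun s => decide (Even (X s + Y s)), fun s t hst heq => ?_⟩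
  rw [decide_eq_decide] at heq
  obtain ⟨-, h | h⟩ := gridGraph_adj.mp hst
  · rw [hstep s t h, Int.even_add_one] at heq
    exact iff_not_self heq
  · rw [hstep t s h, Int.even_add_one] at heq
    exact iff_not_self heq.symm

theorem QuadriculatedDisk.isExactGrid_neighbor {S : Type*} [Finite S] {Δ : QuadriculatedDisk S}
    {a : S → Fin 4} (ha : Δ.IsOrientation a) :
    IsExactGrid (Δ.Neighbor a 0) (Δ.Neighbor a 1) where
  east := ha.neighbor_biUnique 0
  north := ha.neighbor_biUnique 1
  exact A _ f g hclosed := by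
    obtain ⟨h, hh⟩ := Δ.exists_potential (g := Δ.sideCochain a f g)
      (fun _ => SquareGluing.sideCochain_mate ha) fun _ hd => sum_sideCochain_eq_zero ha hd hclosed
    refine ⟨h, ?_, ?_⟩
    all_goals
      rintro _ _ ⟨d, hd, rfl, rfl, hk⟩
      rw [hh d hd, add_sub_cancel_left, SquareGluing.sideCochain, hk]
      rfl

theorem theorem1 {S : Type*} [Fintype S] (Δ : QuadriculatedDisk S) (hS : 2 ≤ Fintype.card S) :
    (∃ c : S → Bool, Δ.IsBicoloring c) ∧
    ∀ c : S → Bool, Δ.IsBicoloring c →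
      ∃ (b w : ℕ) (β : Fin b ≃ {s // c s = true}) (ω : Fin w ≃ {s // c s = false})
        (L : Matrix (Fin b) (Fin b) ℤ) (D : Matrix (Fin b) (Fin w) ℤ)
        (U : Matrix (Fin w) (Fin w) ℤ),
        Δ.blackToWhite β ω = L * D * U ∧
        L.IsLowerTriangular ∧ IsUnit L ∧
        U.IsUpperTriangular ∧ IsUnit U ∧
        IsDefectiveIdentity D ∧
        HasUnitEntries L ∧ HasUnitEntries D ∧ HasUnitEntries U := by
  obtain ⟨a, ha⟩ := Δ.exists_orientation
  have G := QuadriculatedDisk.isExactGrid_neighbor ha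
  refine ⟨?_, fun c hc => ?_⟩
  · obtain ⟨c, hc⟩ := G.exists_coloring
    exact ⟨c, fun s t hst => hc s t (ha.adj_iff.mp hst)⟩
  · have B := hc.isBipartiteWith fun _ _ => ha.adj_iff.mpr
    obtain ⟨b, w, β, ω, L, D, U, hM, hL, hU, hD⟩ :=
      (G.factorsOn B).exists_equiv (fun _ => Finset.mem_filter_univ _)
        fun _ => Finset.mem_filter_univ _
    exact ⟨b, w, β, ω, L, D, U, (ha.blackToWhite_eq β ω).trans hM, hL.isLowerTriangular, hL.isUnit,
      hU.isLowerTriangular.transpose, (Matrix.isUnit_transpose U).mp hU.isUnit, hD,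
      hL.hasUnitEntries, hD.hasUnitEntries, fun i j => hU.hasUnitEntries j i⟩
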